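/- Let $n\ge 1$ and let $\mathbb R^{n,1}$ be $\mathbb R^{n+1}$ with the Lorentzian inner product $\langle X,Y\rangle=\sum_{i=1}^n x_iy_i-x_{n+1}y_{n+1}$. A spacelike hypersurface is a codimension-one embedded $C^2$ submanifold $\mathcal M\subset\mathbb R^{n,1}$ on which $\langle\cdot,\cdot\rangle$ induces a Riemannian metric. Its principal curvatures at a point are the eigenvalues of the Weingarten map $v\mapsto\bar\nabla_v\nu$ on the tangent space, where $\nu$ is the future-directed timelike unit normal field ($\langle\nu,\nu\rangle=-1$). Let $z(X)=\tfrac12\langle X,X\rangle=\tfrac12\bigl(\sum_{i=1}^n x_i^2-x_{n+1}^2\bigr)$, and let $\nabla z$ be the gradient of $z|_{\mathcal M}$ with respect to the induced metric, with $|\nabla z|^2=\langle\nabla z,\nabla z\rangle$. (1) For every $C_0\in\mathbb R$ there is a constant $C$ depending only on $C_0$ (in particular, not on $n$ or $\mathcal M$) such that the following holds. If $\mathcal M\subset\mathbb R^{n,1}$ is a connected spacelike hypersurface which is closed with respect to the Euclidean topology, contains the origin, and has all principal curvatures bounded by $C_0$ in absolute value at every point, then $$|\nabla z(X)|^2\le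 C\,(z(X)+1)^2\qquad\text{for all }X\in\mathcal M.$$ (2) If $\mathcal M\subset\mathbb R^{n,1}$ is a spacelike hypersurface (not necessarily connected and not necessarily containing the origin) which is closed with respect to the Euclidean topology and has bounded principal curvatures, then $\mathcal M$ is complete with respect to its induced metric; that is, every Cauchy sequence for the induced distance (the infimum of the lengths of $C^1$ curves in $\mathcal M$, equal to $\infty$ if there are none) converges in $\mathcal M$ for that distance. -/

import Mathlib

open Set Filter Topology MeasureTheory
open scoped ENNReal

noncomputable section

/-- The space underlying Minkowski space `ℝ^{n,1}`: points `(x, x_{n+1})` with `x ∈ ℝⁿ`.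
Its topology is the Euclidean one. -/
abbrev Mink (n : ℕ) : Type := EuclideanSpace ℝ (Fin n) × ℝ

namespace Mink

variable {n : ℕ}

/-- The Lorentzian inner product `⟨X, Y⟩ = ∑ᵢ xᵢ yᵢ - x_{n+1} y_{n+1}`. -/
def lorentz (X Y : Mink n) : ℝ := inner ℝ X.1 Y.1 - X.2 * Y.2

/-- The Minkowski distance function from the origin, `z(X) = ⟨X, X⟩ / 2`. -/
def z (X : Mink n) : ℝ := lorentz X X / 2

/-- `M` is an (embedded) `C²` submanifold of codimension one: near each of its points it is the
zero set of a `C²` function without critical points. -/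
def IsHypersurface (M : Set (Mink n)) : Prop :=
  ∀ p ∈ M, ∃ (W : Set (Mink n)) (f : Mink n → ℝ), IsOpen W ∧ p ∈ W ∧
    ContDiffOn ℝ 2 f W ∧ (∀ q ∈ W, fderiv ℝ f q ≠ 0) ∧ M ∩ W = {q ∈ W | f q = 0}

/-- `v` is a tangent vector of `M` at `p`: the velocity at `p` of a curve lying in `M`. -/
def IsTangent (M : Set (Mink n)) (p v : Mink n) : Prop :=
  ∃ γ : ℝ → Mink n, γ 0 = p ∧ (∀ᶠ t in 𝓝 0, γ t ∈ M) ∧ HasDerivAt γ v 0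

/-- A spacelike hypersurface: a `C²` submanifold of codimension one on which the Lorentzian metric
induces a Riemannian (that is, positive definite) metric. -/
def IsSpacelikeHypersurface (M : Set (Mink n)) : Prop :=
  IsHypersurface M ∧ ∀ p ∈ M, ∀ v, IsTangent M p v → v ≠ 0 → 0 < lorentz v v

/-- `N` is the future directed timelike unit normal vector of `M` at `p`. -/
def IsUnitNormal (M : Set (Mink n)) (p N : Mink n) : Prop :=
  (∀ v, IsTangent M p v → lorentz N v = 0) ∧ lorentz N N = -1 ∧ 0 < N.2

/-- `κ` is a principal curvature of `M` at `p`: an eigenvalue, with a nonzero tangent eigenvector,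
of the derivative along `M` of the unit normal field `ν` (the Weingarten map `v ↦ ∇̄_v ν`).
Near `p` on `M` the field `ν` is determined by `M`, and so is `A` on tangent vectors. -/
def IsPrincipalCurvature (M : Set (Mink n)) (p : Mink n) (κ : ℝ) : Prop :=
  ∃ (ν : Mink n → Mink n) (A : Mink n →L[ℝ] Mink n),
    (∀ᶠ q in 𝓝[M] p, IsUnitNormal M q (ν q)) ∧ HasFDerivWithinAt ν A M p ∧
      ∃ v, v ≠ 0 ∧ IsTangent M p v ∧ A v = κ • v

/-- All principal curvatures of `M` are bounded by `C₀` in absolute value. -/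
def PrincipalCurvaturesBoundedBy (M : Set (Mink n)) (C₀ : ℝ) : Prop :=
  ∀ p ∈ M, ∀ κ, IsPrincipalCurvature M p κ → |κ| ≤ C₀

/-- `G` is the gradient `∇f(p)` of `f` restricted to `M`, with respect to the induced metric:
the tangent vector with `⟨G, v⟩ = df_p(v)` for all tangent vectors `v`. -/
def IsInducedGradient (M : Set (Mink n)) (f : Mink n → ℝ) (p G : Mink n) : Prop :=
  IsTangent M p G ∧ ∀ v, IsTangent M p v → lorentz G v = fderiv ℝ f p v

theorem lorentz_comm (X Y : Mink n) : lorentz X Y = lorentz Y X := by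
  simp only [lorentz, real_inner_comm, mul_comm]

/-- The squared norm `|∇f(p)|²` does not depend on which vector is used as the gradient. -/
theorem IsInducedGradient.lorentz_self_eq {M : Set (Mink n)} {f : Mink n → ℝ} {p G G' : Mink n}
    (h : IsInducedGradient M f p G) (h' : IsInducedGradient M f p G') :
    lorentz G G = lorentz G' G' := by
  rw [h.2 G h.1, ← h'.2 G h.1, lorentz_comm, h.2 G' h'.1, ← h'.2 G' h'.1]

/-- The length `∫₀¹ ⟨γ', γ'⟩^{1/2} dt` of a curve for the induced metric. -/
def inducedLength (γ : ℝ → Mink n) : ℝ≥0∞ :=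
  ∫⁻ t in Icc (0 : ℝ) 1, ENNReal.ofReal
    (Real.sqrt (lorentz (derivWithin γ (Icc 0 1) t) (derivWithin γ (Icc 0 1) t)))

/-- The distance of the induced metric on `M`: the infimum of the lengths of the `C¹` curves in `M`
from `p` to `q` (it is `∞` if there are none). -/
def inducedEDist (M : Set (Mink n)) (p q : Mink n) : ℝ≥0∞ :=
  ⨅ (γ : ℝ → Mink n) (_ : ContDiffOn ℝ 1 γ (Icc 0 1) ∧ (∀ t ∈ Icc (0 : ℝ) 1, γ t ∈ M) ∧
    γ 0 = p ∧ γ 1 = q), inducedLength γ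

/-- `M` is complete in its induced metric: every Cauchy sequence for the induced distance
converges for the induced distance to a point of `M`. -/
def IsInducedComplete (M : Set (Mink n)) : Prop :=
  ∀ x : ℕ → Mink n, (∀ k, x k ∈ M) →
    (∀ ε : ℝ≥0∞, 0 < ε → ∃ N, ∀ k ≥ N, ∀ l ≥ N, inducedEDist M (x k) (x l) < ε) →
    ∃ p ∈ M, Tendsto (fun k => inducedEDist M (x k) p) atTop (𝓝 0)

end Mink

end

/-! A tangent hyperplane contains no vertical vector, so `M` is locally the graph of a function `u`
with `‖Du‖ < 1`. Such graphs are 1-Lipschitz and `M` is closed, so lifts of segments of `ℝⁿ` cannot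
escape to infinity. The projection of `M` to `ℝⁿ` is a local homeomorphism, and uniqueness of lifts
makes the lifted segments fit together to an entire graph through any given point of `M`
(`exists_isEntireGraphIn`). This graph is open and closed in `M`, so it is all of `M` when `M` is
connected, and it contains every curve in `M` that starts on it.

Fix `a` on the graph and write `z` for `z (X - a)` and `w = ⟨X - a, ν⟩`. Then `∇z = X - a + w ν` and
`|∇z|² = 2z + w²`, so (1) amounts to bounding `w` by `z`. In the direction `∇z`, the derivative of
`z` is `|∇z|²` and that of `w` is the second fundamental form at `(∇z, ∇z)`, at most `|C₀| |∇z|²` in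
absolute value. The sublevel sets of `z` are compact. At a maximum of `w - (|C₀| + 1) z` on one of
them `∇z` must vanish, since a small move against `∇z` would stay in the set and increase the
function. There `2z + w² = 0` with `z ≥ 0`, so `z = w = 0`. With the same argument for `-w` this
gives `|w| ≤ (|C₀| + 1) z` (`abs_lorentz_graphNormal_le`).

For (2), the gradient bound says that `log (z + 1)` is Lipschitz for the induced metric. Hence a
Cauchy sequence, and short curves joining its late terms, remain in a compact part of one entire
graph. There the induced and Euclidean metrics are comparable, and completeness of `ℝⁿ` finishes the
proof. -/

noncomputable section

namespace Mink

variable {n : ℕ}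

/-! ### Tangent vectors and local graphs -/

/-- A vector in the kernel of the differential of a defining function is tangent. -/
theorem isTangent_of_fderiv_eq_zero {M W : Set (Mink n)} {f : Mink n → ℝ} {p v : Mink n}
    (hW : IsOpen W) (hpW : p ∈ W) (hf : ContDiffOn ℝ 2 f W) (hne : fderiv ℝ f p ≠ 0)
    (hMW : M ∩ W = {q ∈ W | f q = 0}) (hp : p ∈ M) (hv : fderiv ℝ f p v = 0) :
    IsTangent M p v := by
  have hfp : f p = 0 := (hMW ▸ (⟨hp, hpW⟩ : p ∈ M ∩ W) : p ∈ {q ∈ W | f q = 0}).2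
  have hs : HasStrictFDerivAt f (fderiv ℝ f p) p :=
    (hf.contDiffAt (hW.mem_nhds hpW)).hasStrictFDerivAt (by norm_num)
  have hr : (fderiv ℝ f p).range = ⊤ := by
    have := LinearMap.surjective (f := (fderiv ℝ f p : Mink n →ₗ[ℝ] ℝ))
      (fun h => hne (ContinuousLinearMap.coe_injective h))
    exact LinearMap.range_eq_top.2 this
  let k : (fderiv ℝ f p).ker := ⟨v, hv⟩
  have hline : HasDerivAt (fun t : ℝ => t • k) k 0 := by
    simpa using (hasDerivAt_id (0 : ℝ)).smul_const k
  have hG := (hs.to_implicitFunction hr).hasFDerivAt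
  have hG0 : hs.implicitFunction f (fderiv ℝ f p) hr (f p) 0 = p :=
    hs.implicitFunction_apply_image hr
  have hγ : HasDerivAt (fun t : ℝ => hs.implicitFunction f (fderiv ℝ f p) hr (f p) (t • k)) v 0 := by
    have := HasFDerivAt.comp_hasDerivAt (0 : ℝ) (by simpa using hG) hline
    simpa [k, Function.comp_def] using this
  refine ⟨_, by simp, ?_, hγ⟩
  have hmap := hs.map_implicitFunction_eq hr
  have htend : Tendsto (fun t : ℝ => (f p, t • k)) (𝓝 0) (𝓝 (f p, 0)) := by
    refine tendsto_const_nhds.prodMk_nhds ?_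
    simpa using hline.continuousAt.tendsto
  have hmemW := hγ.continuousAt.preimage_mem_nhds
    (show W ∈ 𝓝 _ by simpa [hG0] using hW.mem_nhds hpW)
  filter_upwards [htend.eventually hmap, hmemW] with t ht htW
  have : hs.implicitFunction f (fderiv ℝ f p) hr (f p) (t • k) ∈ {q ∈ W | f q = 0} :=
    ⟨htW, by simpa [hfp] using ht⟩
  exact (hMW ▸ this : _ ∈ M ∩ W).1

/-- Lifted tangent vectors of a graph contained in `M` are tangent to `M`. -/
theorem isTangent_graph {M : Set (Mink n)} {u : EuclideanSpace ℝ (Fin n) → ℝ}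
    {x : EuclideanSpace ℝ (Fin n)} (hM : ∀ᶠ y in 𝓝 x, (y, u y) ∈ M)
    (hu : DifferentiableAt ℝ u x) (v : EuclideanSpace ℝ (Fin n)) :
    IsTangent M (x, u x) (v, fderiv ℝ u x v) := by
  have hline : HasDerivAt (fun t : ℝ => x + t • v) v 0 := by
    simpa using ((hasDerivAt_id (0 : ℝ)).smul_const v).const_add x
  refine ⟨fun t => (x + t • v, u (x + t • v)), by simp, ?_, ?_⟩
  · have : Tendsto (fun t : ℝ => x + t • v) (𝓝 0) (𝓝 x) := by
      simpa using hline.continuousAt.tendsto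
    exact this.eventually hM
  · have h2 : HasDerivAt (fun t : ℝ => u (x + t • v)) (fderiv ℝ u x v) 0 :=
      HasFDerivAt.comp_hasDerivAt (0 : ℝ) (by simpa using hu.hasFDerivAt) hline
    exact hline.prodMk h2

/-- The operator norm is attained at the Riesz representative, so strictness survives the supremum.
-/
theorem norm_lt_one_of_sq_lt {F : Type*} [NormedAddCommGroup F] [InnerProductSpace ℝ F]
    [CompleteSpace F] (L : F →L[ℝ] ℝ) (h : ∀ v, v ≠ 0 → (L v) ^ 2 < ‖v‖ ^ 2) : ‖L‖ < 1 := by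
  set w := (InnerProductSpace.toDual ℝ F).symm L with hw
  have hL : ‖L‖ = ‖w‖ := by simp [hw]
  have hLw : L w = ‖w‖ ^ 2 := by
    rw [← InnerProductSpace.toDual_symm_apply (y := L) (x := w), ← hw, real_inner_self_eq_norm_sq]
  by_cases h0 : w = 0
  · simp [hL, h0]
  · have h1 := h w h0
    have h2 : 0 < ‖w‖ := norm_pos_iff.2 h0
    rw [hLw] at h1
    rw [hL]
    nlinarith [sq_nonneg (‖w‖ - 1), pow_pos h2 2, pow_pos h2 3]

theorem IsSpacelikeHypersurface.norm_fderiv_lt_one {M : Set (Mink n)}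
    (hM : IsSpacelikeHypersurface M) {u : EuclideanSpace ℝ (Fin n) → ℝ}
    {x : EuclideanSpace ℝ (Fin n)} (hu : ∀ᶠ y in 𝓝 x, (y, u y) ∈ M)
    (hd : DifferentiableAt ℝ u x) : ‖fderiv ℝ u x‖ < 1 := by
  refine norm_lt_one_of_sq_lt _ fun v hv => ?_
  have := hM.2 _ hu.self_of_nhds _ (isTangent_graph hu hd v) (by simp [hv])
  simp only [lorentz, real_inner_self_eq_norm_sq] at this
  nlinarith

/-- A spacelike hypersurface is locally the graph of a `C²` function with gradient of norm less
than one. -/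
theorem IsSpacelikeHypersurface.exists_local_graph {M : Set (Mink n)}
    (hM : IsSpacelikeHypersurface M) {p : Mink n} (hp : p ∈ M) :
    ∃ (u : EuclideanSpace ℝ (Fin n) → ℝ) (ρ : ℝ) (V : Set (Mink n)), 0 < ρ ∧ IsOpen V ∧ p ∈ V ∧
      ContDiffOn ℝ 2 u (Metric.ball p.1 ρ) ∧
      (∀ x ∈ Metric.ball p.1 ρ, (x, u x) ∈ M ∧ ‖fderiv ℝ u x‖ < 1) ∧
      ∀ q ∈ M ∩ V, q.1 ∈ Metric.ball p.1 ρ ∧ u q.1 = q.2 := by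
  obtain ⟨W, f, hW, hpW, hf, hne, hMW⟩ := hM.1 p hp
  have hfp : f p = 0 := (hMW ▸ (⟨hp, hpW⟩ : p ∈ M ∩ W) : p ∈ {q ∈ W | f q = 0}).2
  have hcd : ContDiffAt ℝ 2 f p := hf.contDiffAt (hW.mem_nhds hpW)
  -- The vertical vector is timelike; in the kernel of the differential it would be tangent.
  have hvert : fderiv ℝ f p (0, 1) ≠ 0 := by
    intro h0
    have := hM.2 p hp _ (isTangent_of_fderiv_eq_zero hW hpW hf (hne p hpW) hMW hp h0)
      (by simp)
    norm_num [lorentz] at this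
  have hinv : (fderiv ℝ f p ∘L .inr ℝ (EuclideanSpace ℝ (Fin n)) ℝ).IsInvertible := by
    refine ⟨ContinuousLinearEquiv.unitsEquivAut ℝ (Units.mk0 _ hvert), ?_⟩
    ext
    simp
  set u := hcd.implicitFunction (by norm_num) hinv with hu
  have hup : u p.1 = p.2 := hcd.implicitFunction_apply_self (by norm_num) hinv
  have hucd : ContDiffAt ℝ 2 u p.1 := hcd.contDiffAt_implicitFunction (by norm_num) hinv
  have hgW : ∀ᶠ x in 𝓝 p.1, (x, u x) ∈ W := by
    have : ContinuousAt (fun x => (x, u x)) p.1 := continuousAt_id.prodMk hucd.continuousAt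
    exact this.preimage_mem_nhds (hW.mem_nhds (by simpa [hup] using hpW))
  have h1 := hcd.eventually_apply_implicitFunction (by norm_num) hinv
  have h2 := hucd.eventually (by norm_num)
  obtain ⟨ρ, hρ, hball⟩ := Metric.eventually_nhds_iff_ball.1 (h1.and (hgW.and h2))
  have hgM : ∀ x ∈ Metric.ball p.1 ρ, (x, u x) ∈ M := fun x hx => by
    have hx' := hball x hx
    have : (x, u x) ∈ {q ∈ W | f q = 0} := ⟨hx'.2.1, by rw [← hfp]; exact hx'.1⟩
    exact (hMW ▸ this : _ ∈ M ∩ W).1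
  have h3 := hcd.eventually_apply_eq_iff_implicitFunction (by norm_num) hinv
  have h4 : ∀ᶠ q : Mink n in 𝓝 p, q.1 ∈ Metric.ball p.1 ρ :=
    continuous_fst.continuousAt.preimage_mem_nhds (Metric.ball_mem_nhds _ hρ)
  obtain ⟨V, hV, hVo, hpV⟩ := eventually_nhds_iff.1 (h3.and (h4.and (hW.mem_nhds hpW)))
  refine ⟨u, ρ, V, hρ, hVo, hpV, fun x hx => (hball x hx).2.2.contDiffWithinAt, fun x hx =>
    ⟨hgM x hx, hM.norm_fderiv_lt_one ?_ ((hball x hx).2.2.differentiableAt (by norm_num))⟩, ?_⟩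
  · filter_upwards [Metric.isOpen_ball.mem_nhds hx] with y hy using hgM y hy
  · rintro q ⟨hqM, hqV⟩
    obtain ⟨ha, hb, hc⟩ := hV q hqV
    refine ⟨hb, ha.1 ?_⟩
    rw [hfp]
    exact (hMW ▸ (⟨hqM, hc⟩ : q ∈ M ∩ W) : q ∈ {q ∈ W | f q = 0}).2


theorem abs_sub_le_norm_sub {F : Type*} [NormedAddCommGroup F] [NormedSpace ℝ F] {u : F → ℝ}
    {s : Set F} (hs : Convex ℝ s) (hso : IsOpen s) (hu : DifferentiableOn ℝ u s)
    (h : ∀ x ∈ s, ‖fderiv ℝ u x‖ < 1) {x y : F} (hx : x ∈ s) (hy : y ∈ s) :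
    |u x - u y| ≤ ‖x - y‖ := by
  have := hs.norm_image_sub_le_of_norm_fderiv_le (f := u) (C := 1)
    (fun x hx => hu.differentiableAt (hso.mem_nhds hx)) (fun x hx => (h x hx).le) hy hx
  simpa using this

/-! ### From local graphs to entire graphs -/

/-- The radius of the local graphs is uniform on compact sets. -/
theorem IsSpacelikeHypersurface.exists_uniform_radius {M K : Set (Mink n)}
    (hM : IsSpacelikeHypersurface M) (hK : IsCompact K) (hKM : K ⊆ M) :
    ∃ r > 0, ∀ q ∈ K, ∃ u : EuclideanSpace ℝ (Fin n) → ℝ,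
      ContDiffOn ℝ 2 u (Metric.ball q.1 r) ∧ u q.1 = q.2 ∧
      ∀ x ∈ Metric.ball q.1 r, (x, u x) ∈ M ∧ ‖fderiv ℝ u x‖ < 1 := by
  refine hK.induction_on (p := fun K => ∃ r > 0, ∀ q ∈ K,
    ∃ u : EuclideanSpace ℝ (Fin n) → ℝ, ContDiffOn ℝ 2 u (Metric.ball q.1 r) ∧ u q.1 = q.2 ∧
      ∀ x ∈ Metric.ball q.1 r, (x, u x) ∈ M ∧ ‖fderiv ℝ u x‖ < 1) ?_ ?_ ?_ ?_
  · exact ⟨1, one_pos, by simp⟩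
  · rintro s t hst ⟨r, hr, h⟩
    exact ⟨r, hr, fun q hq => h q (hst hq)⟩
  · rintro s t ⟨r, hr, h⟩ ⟨r', hr', h'⟩
    refine ⟨min r r', lt_min hr hr', ?_⟩
    rintro q (hq | hq)
    · obtain ⟨u, h1, h2, h3⟩ := h q hq
      have := Metric.ball_subset_ball (x := q.1) (min_le_left r r')
      exact ⟨u, h1.mono this, h2, fun x hx => h3 x (this hx)⟩
    · obtain ⟨u, h1, h2, h3⟩ := h' q hq
      have := Metric.ball_subset_ball (x := q.1) (min_le_right r r')
      exact ⟨u, h1.mono this, h2, fun x hx => h3 x (this hx)⟩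
  · intro p hp
    obtain ⟨u, ρ, V, hρ, hV, hpV, hu, hg, hq⟩ := hM.exists_local_graph (hKM hp)
    have hb : ∀ᶠ q : Mink n in 𝓝 p, q.1 ∈ Metric.ball p.1 (ρ / 2) :=
      continuous_fst.continuousAt.preimage_mem_nhds (Metric.ball_mem_nhds _ (half_pos hρ))
    refine ⟨{q | q.1 ∈ Metric.ball p.1 (ρ / 2)} ∩ V ∩ K, ?_, ρ / 2, half_pos hρ, ?_⟩
    · exact inter_mem (mem_nhdsWithin_of_mem_nhds (inter_mem hb (hV.mem_nhds hpV)))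
        self_mem_nhdsWithin
    · rintro q ⟨⟨hqb, hqV⟩, hqK⟩
      have hsub : Metric.ball q.1 (ρ / 2) ⊆ Metric.ball p.1 ρ := by
        refine Metric.ball_subset_ball' ?_
        have := Metric.mem_ball.1 hqb
        linarith
      exact ⟨u, hu.mono hsub, (hq q ⟨hKM hqK, hqV⟩).2, fun x hx => hg x (hsub hx)⟩

/-- Segments in the base lift to a closed spacelike hypersurface. -/
theorem IsSpacelikeHypersurface.exists_segment_lift {M : Set (Mink n)}
    (hM : IsSpacelikeHypersurface M) (hMc : IsClosed M) {a : Mink n} (ha : a ∈ M)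
    (v : EuclideanSpace ℝ (Fin n)) :
    ∃ h : ℝ → ℝ, ContinuousOn h (Icc 0 1) ∧ h 0 = a.2 ∧
      ∀ t ∈ Icc (0 : ℝ) 1, (a.1 + t • v, h t) ∈ M := by
  -- The lift at time `t` has moved by at most `t * ‖v‖` in height, so it never leaves this compact
  -- box and one radius `r` serves for every extension step.
  set K : Set (Mink n) := (Metric.closedBall a.1 ‖v‖ ×ˢ Metric.closedBall a.2 ‖v‖) ∩ M with hKdef
  have hK : IsCompact K :=
    ((isCompact_closedBall _ _).prod (isCompact_closedBall _ _)).inter_right hMc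
  obtain ⟨r, hr, hloc⟩ := hM.exists_uniform_radius hK inter_subset_right
  obtain ⟨m, hm⟩ := exists_nat_gt (‖v‖ / r)
  have hm0 : (0 : ℝ) < m := lt_of_le_of_lt (by positivity) hm
  have hmr : ‖v‖ / m < r := by
    rw [div_lt_iff₀ hm0]
    rw [div_lt_iff₀ hr] at hm
    linarith
  have key : ∀ k : ℕ, k ≤ m → ∃ h : ℝ → ℝ, ContinuousOn h (Icc 0 (k / m : ℝ)) ∧ h 0 = a.2 ∧
      ∀ t ∈ Icc (0 : ℝ) (k / m), (a.1 + t • v, h t) ∈ M ∧ |h t - a.2| ≤ t * ‖v‖ := by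
    intro k
    induction k with
    | zero =>
      refine fun _ => ⟨fun _ => a.2, continuousOn_const, rfl, fun t ht => ?_⟩
      have : t = 0 := by simpa using ht
      simp [this, ha]
    | succ k ih =>
      intro hk
      obtain ⟨h, hc, h0, hh⟩ := ih (by omega)
      set s : ℝ := k / m with hs
      have hs0 : 0 ≤ s := by positivity
      have hs1 : s ≤ 1 := by
        rw [hs, div_le_one hm0]
        exact_mod_cast (by omega : k ≤ m)
      have hsucc : ((k + 1 : ℕ) : ℝ) / m = s + 1 / m := by
        push_cast
        rw [hs]
        ring
      obtain ⟨hsM, hsb⟩ := hh s ⟨hs0, le_rfl⟩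
      have hsv : s * ‖v‖ ≤ ‖v‖ := mul_le_of_le_one_left (norm_nonneg _) hs1
      obtain ⟨u, hu, hus, hg⟩ := hloc (a.1 + s • v, h s) ⟨⟨by
        simpa [norm_smul, abs_of_nonneg hs0] using hsv, by
        simpa [Real.dist_eq] using hsb.trans hsv⟩, hsM⟩
      simp only at hu hus hg
      have hball : ∀ t ∈ Icc s (s + 1 / m), a.1 + t • v ∈ Metric.ball (a.1 + s • v) r := by
        intro t ht
        rw [Metric.mem_ball, dist_add_left, dist_eq_norm, ← sub_smul, norm_smul, Real.norm_eq_abs,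
          abs_of_nonneg (by linarith [ht.1])]
        refine lt_of_le_of_lt ?_ hmr
        rw [div_eq_mul_one_div, mul_comm]
        exact mul_le_mul_of_nonneg_left (by linarith [ht.2]) (norm_nonneg _)
      have hcu : ContinuousOn (fun t => u (a.1 + t • v)) (Icc s (s + 1 / m)) :=
        hu.continuousOn.comp (by fun_prop) hball
      rw [hsucc]
      refine ⟨fun t => if t ≤ s then h t else u (a.1 + t • v), ?_, by simp [hs0, h0], ?_⟩
      · rw [← Icc_union_Icc_eq_Icc hs0 (by simp : s ≤ s + 1 / m)]
        refine ContinuousOn.union_of_isClosed (hc.congr fun t ht => if_pos ht.2)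
          (hcu.congr fun t ht => ?_) isClosed_Icc isClosed_Icc
        by_cases hts : t ≤ s
        · have : t = s := le_antisymm hts ht.1
          simp [this, hus]
        · simp [hts]
      · intro t ht
        by_cases hts : t ≤ s
        · simpa [hts] using hh t ⟨ht.1, hts⟩
        · have ht' : t ∈ Icc s (s + 1 / m) := ⟨(not_le.1 hts).le, ht.2⟩
          simp only [hts, if_false]
          refine ⟨(hg _ (hball t ht')).1, ?_⟩
          have h1 : |u (a.1 + t • v) - u (a.1 + s • v)| ≤ (t - s) * ‖v‖ := by
            refine (abs_sub_le_norm_sub (convex_ball _ _) Metric.isOpen_ball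
              (hu.differentiableOn (by norm_num)) (fun x hx => (hg x hx).2) (hball t ht')
              (Metric.mem_ball_self hr)).trans (le_of_eq ?_)
            rw [add_sub_add_left_eq_sub, ← sub_smul, norm_smul, Real.norm_eq_abs,
              abs_of_nonneg (by linarith [ht'.1])]
          rw [hus] at h1
          calc |u (a.1 + t • v) - a.2| ≤ |u (a.1 + t • v) - h s| + |h s - a.2| :=
                abs_sub_le _ _ _
            _ ≤ (t - s) * ‖v‖ + s * ‖v‖ := add_le_add h1 hsb
            _ = t * ‖v‖ := by ring
  obtain ⟨h, h1, h2, h3⟩ := key m le_rfl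
  rw [div_self hm0.ne'] at h1 h3
  exact ⟨h, h1, h2, fun t ht => (h3 t ht).1⟩

/-- The projection of a spacelike hypersurface to `ℝⁿ` is a local homeomorphism. -/
theorem IsSpacelikeHypersurface.isLocalHomeomorph_fst {M : Set (Mink n)}
    (hM : IsSpacelikeHypersurface M) : IsLocalHomeomorph fun q : M => q.1.1 := by
  have hcont : Continuous fun q : M => q.1.1 := by fun_prop
  have hopen : IsOpenMap fun q : M => q.1.1 := by
    rw [isOpenMap_iff_nhds_le]
    intro p
    obtain ⟨u, ρ, V, hρ, hV, hpV, hu, hg, hq⟩ := hM.exists_local_graph p.2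
    have hup : u p.1.1 = p.1.2 := (hq p.1 ⟨p.2, hpV⟩).2
    have hb := Metric.ball_mem_nhds p.1.1 hρ
    intro s hs
    rw [mem_map, mem_nhds_subtype] at hs
    obtain ⟨t, ht, hts⟩ := hs
    have hc : ContinuousAt (fun x => (x, u x)) p.1.1 :=
      continuousAt_id.prodMk (hu.continuousOn.continuousAt hb)
    filter_upwards [hb, hc.preimage_mem_nhds (by simpa [hup] using ht)] with x hx hxt
    exact @hts ⟨(x, u x), (hg x hx).1⟩ hxt
  rw [isLocalHomeomorph_iff_isOpenEmbedding_restrict]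
  intro p
  obtain ⟨u, ρ, V, hρ, hV, hpV, hu, hg, hq⟩ := hM.exists_local_graph p.2
  have hVo : IsOpen ((↑) ⁻¹' V : Set M) := hV.preimage continuous_subtype_val
  refine ⟨_, hVo.mem_nhds hpV, .of_continuous_injective_isOpenMap
    (hcont.comp continuous_subtype_val) ?_ (hopen.comp hVo.isOpenMap_subtype_val)⟩
  rintro ⟨⟨q, hqM⟩, hqV⟩ ⟨⟨q', hqM'⟩, hqV'⟩ h
  have h1 : q.1 = q'.1 := h
  have h2 : q.2 = q'.2 := by
    rw [← (hq q ⟨hqM, hqV⟩).2, ← (hq q' ⟨hqM', hqV'⟩).2, h1]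
  simp only [Subtype.mk.injEq]
  exact Prod.ext h1 h2

/-- `M` contains the graph of the `C²` function `u`, with gradient of norm less than one, as a
relatively open subset. -/
structure IsEntireGraphIn (u : EuclideanSpace ℝ (Fin n) → ℝ) (M : Set (Mink n)) : Prop where
  contDiff : ContDiff ℝ 2 u
  norm_fderiv_lt_one : ∀ x, ‖fderiv ℝ u x‖ < 1
  mem : ∀ x, (x, u x) ∈ M
  eventually_eq : ∀ x, ∀ᶠ q in 𝓝[M] (x, u x), q.2 = u q.1

/-- Through each point of a closed spacelike hypersurface passes an entire graph contained in it. -/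
theorem IsSpacelikeHypersurface.exists_isEntireGraphIn {M : Set (Mink n)}
    (hM : IsSpacelikeHypersurface M) (hMc : IsClosed M) {a : Mink n} (ha : a ∈ M) :
    ∃ u : EuclideanSpace ℝ (Fin n) → ℝ, u a.1 = a.2 ∧ IsEntireGraphIn u M := by
  choose h hc h0 hh using fun x => hM.exists_segment_lift hMc ha (x - a.1)
  let f : C(unitInterval × EuclideanSpace ℝ (Fin n), EuclideanSpace ℝ (Fin n)) :=
    ⟨fun q => a.1 + (q.1 : ℝ) • (q.2 - a.1), by fun_prop⟩
  let g : unitInterval × EuclideanSpace ℝ (Fin n) → M := fun q =>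
    ⟨(a.1 + (q.1 : ℝ) • (q.2 - a.1), h q.2 q.1), hh q.2 q.1 q.1.2⟩
  have hsep : IsSeparatedMap fun q : M => q.1.1 := T2Space.isSeparatedMap _
  -- The lifts were chosen separately for each endpoint; uniqueness of lifts through a separated
  -- local homeomorphism makes them jointly continuous.
  have hg : Continuous g := by
    refine hM.isLocalHomeomorph_fst.continuous_lift hsep f (by ext; rfl) ?_ fun x => ?_
    · refine Continuous.subtype_mk ?_ _
      simp only [Icc.coe_zero, h0, zero_smul, add_zero]
      exact continuous_const
    · refine Continuous.subtype_mk (Continuous.prodMk (by fun_prop) ?_) _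
      exact continuousOn_iff_continuous_domRestrict.1 (hc x)
  let s : EuclideanSpace ℝ (Fin n) → M := fun x => g (1, x)
  have hs : Continuous s := by fun_prop
  have hs1 : ∀ x, (s x).1.1 = x := fun x => by simp [s, g]
  set u : EuclideanSpace ℝ (Fin n) → ℝ := fun x => (s x).1.2 with hu
  have hsu : ∀ x, (s x).1 = (x, u x) := fun x => Prod.ext (hs1 x) rfl
  have hmem : ∀ x, (x, u x) ∈ M := fun x => hsu x ▸ (s x).2
  have huc : Continuous u := by fun_prop
  have hlocal : ∀ x, ContDiffAt ℝ 2 u x ∧ ∀ᶠ q in 𝓝[M] (x, u x), q.2 = u q.1 := by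
    intro x
    obtain ⟨w, ρ, V, hρ, hV, hpV, hw, hgr, hq⟩ := hM.exists_local_graph (hmem x)
    have hV' : ∀ᶠ y in 𝓝 x, (y, u y) ∈ V :=
      (continuous_id.prodMk huc).continuousAt.preimage_mem_nhds (hV.mem_nhds hpV)
    have heq : u =ᶠ[𝓝 x] w := by
      filter_upwards [hV'] with y hy
      exact (hq (y, u y) ⟨hmem y, hy⟩).2.symm
    refine ⟨(hw.contDiffAt (Metric.ball_mem_nhds _ hρ)).congr_of_eventuallyEq heq, ?_⟩
    have hfst : Tendsto (fun q : Mink n => q.1) (𝓝[M] (x, u x)) (𝓝 x) :=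
      (continuous_fst.tendsto (x, u x)).mono_left nhdsWithin_le_nhds
    filter_upwards [hfst.eventually heq, self_mem_nhdsWithin,
      mem_nhdsWithin_of_mem_nhds (hV.mem_nhds hpV)] with q hq1 hqM hqV
    rw [hq1, (hq q ⟨hqM, hqV⟩).2]
  refine ⟨u, ?_, contDiff_iff_contDiffAt.2 fun x => (hlocal x).1, fun x =>
    hM.norm_fderiv_lt_one (Eventually.of_forall hmem) ((hlocal x).1.differentiableAt (by norm_num)),
    hmem, fun x => (hlocal x).2⟩
  -- The segment from `a.1` to itself is constant, so by uniqueness its lift is constantly `a`;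
  -- hence `u a.1 = a.2`.
  have hgt : Continuous fun t : unitInterval => g (t, a.1) := by fun_prop
  have hconst : (fun t : unitInterval => g (t, a.1)) = fun _ => ⟨a, ha⟩ := by
    refine hsep.eq_of_comp_eq hM.isLocalHomeomorph_fst.isLocallyInjective hgt continuous_const ?_
      0 ?_
    · ext t
      simp [g]
    · exact Subtype.ext (Prod.ext (by simp [g]) (by simp [g, h0]))
  have := congr_fun hconst 1
  exact congr_arg (fun q : M => q.1.2) this

namespace IsEntireGraphIn

variable {u : EuclideanSpace ℝ (Fin n) → ℝ} {M : Set (Mink n)}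

/-- A preconnected subset of `M` that meets the graph lies in the graph. -/
theorem eq_of_isPreconnected (hu : IsEntireGraphIn u M) {T : Set (Mink n)}
    (hT : IsPreconnected T) (hTM : T ⊆ M) {a : Mink n} (haT : a ∈ T) (ha : a.2 = u a.1)
    {q : Mink n} (hq : q ∈ T) : q.2 = u q.1 := by
  by_contra hne
  have hopen : ∀ x, ∃ O : Set (Mink n), IsOpen O ∧ (x, u x) ∈ O ∧ ∀ q ∈ O ∩ M, q.2 = u q.1 := by
    intro x
    obtain ⟨O, hO, hxO, h⟩ := mem_nhdsWithin.1 (hu.eventually_eq x)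
    exact ⟨O, hO, hxO, h⟩
  choose O hO hxO hOM using hopen
  have hc : IsOpen {q : Mink n | q.2 ≠ u q.1} :=
    isOpen_ne_fun continuous_snd (hu.contDiff.continuous.comp continuous_fst)
  -- A neighbourhood of the graph and the complement of the graph are open, cover `T` and both meet
  -- `T`, yet are disjoint within `M`.
  obtain ⟨y, hyT, hyO, hy⟩ := hT (⋃ x, O x) _ (isOpen_iUnion hO) hc (fun y _ => by
      by_cases h : y.2 = u y.1
      · exact Or.inl (mem_iUnion.2 ⟨y.1, by have := hxO y.1; rwa [← h] at this⟩)
      · exact Or.inr h) ⟨a, haT, mem_iUnion.2 ⟨a.1, by have := hxO a.1; rwa [← ha] at this⟩⟩ ⟨q, hq, hne⟩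
  obtain ⟨x, hx⟩ := mem_iUnion.1 hyO
  exact hy (hOM x y ⟨hx, hTM hyT⟩)

end IsEntireGraphIn

/-! ### Lorentzian calculus and extremal eigenvalues -/

theorem lorentz_add_left (X Y Z : Mink n) : lorentz (X + Y) Z = lorentz X Z + lorentz Y Z := by
  simp only [lorentz, Prod.fst_add, Prod.snd_add, inner_add_left]
  ring

theorem lorentz_smul_left (c : ℝ) (X Y : Mink n) : lorentz (c • X) Y = c * lorentz X Y := by
  simp only [lorentz, Prod.smul_fst, Prod.smul_snd, real_inner_smul_left, smul_eq_mul]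
  ring

theorem lorentz_sub_left (X Y Z : Mink n) : lorentz (X - Y) Z = lorentz X Z - lorentz Y Z := by
  simp only [lorentz, Prod.fst_sub, Prod.snd_sub, inner_sub_left]
  ring

theorem hasDerivWithinAt_fst {X : ℝ → Mink n} {X' : Mink n} {s : Set ℝ} {t : ℝ}
    (hX : HasDerivWithinAt X X' s t) : HasDerivWithinAt (fun t => (X t).1) X'.1 s t :=
  (ContinuousLinearMap.fst ℝ (EuclideanSpace ℝ (Fin n)) ℝ).hasFDerivAt.comp_hasDerivWithinAt t hX

theorem hasDerivWithinAt_snd {X : ℝ → Mink n} {X' : Mink n} {s : Set ℝ} {t : ℝ}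
    (hX : HasDerivWithinAt X X' s t) : HasDerivWithinAt (fun t => (X t).2) X'.2 s t :=
  (ContinuousLinearMap.snd ℝ (EuclideanSpace ℝ (Fin n)) ℝ).hasFDerivAt.comp_hasDerivWithinAt t hX

theorem hasDerivWithinAt_lorentz {X Y : ℝ → Mink n} {X' Y' : Mink n} {s : Set ℝ} {t : ℝ}
    (hX : HasDerivWithinAt X X' s t) (hY : HasDerivWithinAt Y Y' s t) :
    HasDerivWithinAt (fun t => lorentz (X t) (Y t)) (lorentz X' (Y t) + lorentz (X t) Y') s t := by
  have h1 := (hasDerivWithinAt_fst hX).inner ℝ (hasDerivWithinAt_fst hY)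
  have h2 := (hasDerivWithinAt_snd hX).mul (hasDerivWithinAt_snd hY)
  refine (h1.sub h2).congr_deriv ?_
  simp only [lorentz]
  ring

theorem hasDerivAt_lorentz {X Y : ℝ → Mink n} {X' Y' : Mink n} {t : ℝ}
    (hX : HasDerivAt X X' t) (hY : HasDerivAt Y Y' t) :
    HasDerivAt (fun t => lorentz (X t) (Y t)) (lorentz X' (Y t) + lorentz (X t) Y') t := by
  rw [← hasDerivWithinAt_univ] at *
  exact hasDerivWithinAt_lorentz hX hY

/-- First-order condition at a zero of a nonnegative quadratic form. The values at `t = ±1` give `c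
≥ 0`, and testing with denominator `c + 1` avoids the case `c = 0`. -/
theorem eq_zero_of_forall_nonneg_two_mul_add {b c : ℝ} (h : ∀ t : ℝ, 0 ≤ 2 * t * b + t ^ 2 * c) :
    b = 0 := by
  have h1 := h 1
  have h2 := h (-1)
  have hc : 0 ≤ c := by linarith
  have h3 := h (-b / (c + 1))
  have h4 : 2 * (-b / (c + 1)) * b + (-b / (c + 1)) ^ 2 * c = -(b ^ 2 * (c + 2)) / (c + 1) ^ 2 := by
    field_simp
    ring
  rw [h4, le_div_iff₀ (by positivity)] at h3
  have : b ^ 2 = 0 := by nlinarith [sq_nonneg b, mul_nonneg (sq_nonneg b) hc]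
  simpa using this

/-- A symmetric bilinear form is bounded by its greatest eigenvalue relative to a positive definite
one. -/
theorem exists_eigenvector_of_posDef {F : Type*} [NormedAddCommGroup F] [NormedSpace ℝ F]
    [FiniteDimensional ℝ F] (g h : F →L[ℝ] F →L[ℝ] ℝ) (hg : ∀ v w, g v w = g w v)
    (hpos : ∀ v, v ≠ 0 → 0 < g v v) (hh : ∀ v w, h v w = h w v) {v : F} (hv : v ≠ 0) :
    ∃ (κ : ℝ) (v₀ : F), v₀ ≠ 0 ∧ (∀ w, h v₀ w = κ * g v₀ w) ∧ h v v ≤ κ * g v v := by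
  have := FiniteDimensional.proper_real F
  have hne : (Metric.sphere (0 : F) 1).Nonempty :=
    ⟨‖v‖⁻¹ • v, by simp [norm_smul, norm_ne_zero_iff.2 hv]⟩
  have hS : ∀ w ∈ Metric.sphere (0 : F) 1, w ≠ 0 := by
    rintro w hw rfl
    simp at hw
  -- The Rayleigh quotient is homogeneous of degree zero, so its maximum on the unit sphere is
  -- global.
  obtain ⟨v₀, hv₀, hmax⟩ := (isCompact_sphere (0 : F) 1).exists_isMaxOn hne
    (f := fun w => h w w / g w w)
    (ContinuousOn.div (by fun_prop) (by fun_prop) fun w hw => (hpos w (hS w hw)).ne')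
  set κ := h v₀ v₀ / g v₀ v₀ with hκ
  have hq : ∀ w, h w w ≤ κ * g w w := by
    intro w
    by_cases hw : w = 0
    · simp [hw]
    · have h1 : ‖w‖⁻¹ • w ∈ Metric.sphere (0 : F) 1 := by
        simp [norm_smul, norm_ne_zero_iff.2 hw]
      have h2 : h (‖w‖⁻¹ • w) (‖w‖⁻¹ • w) / g (‖w‖⁻¹ • w) (‖w‖⁻¹ • w) ≤ κ := hmax h1
      simp only [map_smul, _root_.smul_apply, smul_eq_mul] at h2
      have hn : ‖w‖⁻¹ ≠ 0 := inv_ne_zero (norm_ne_zero_iff.2 hw)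
      rwa [mul_div_mul_left _ _ hn, mul_div_mul_left _ _ hn, div_le_iff₀ (hpos w hw)] at h2
  have h0 : h v₀ v₀ = κ * g v₀ v₀ := (div_mul_cancel₀ _ (hpos v₀ (hS v₀ hv₀)).ne').symm
  refine ⟨κ, v₀, hS v₀ hv₀, fun w => ?_, hq v⟩
  -- The form `κ g - h` is nonnegative and vanishes at `v₀`, so `v₀` lies in its kernel.
  have : κ * g v₀ w - h v₀ w = 0 := by
    refine eq_zero_of_forall_nonneg_two_mul_add (c := κ * g w w - h w w) fun t => ?_
    have := hq (v₀ + t • w)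
    simp only [map_add, map_smul, _root_.add_apply, _root_.smul_apply,
      smul_eq_mul] at this
    rw [hg w v₀, hh w v₀, h0] at this
    linarith
  linarith

/-! ### Unit normal, second fundamental form and principal curvatures of the graph -/

/-- The tangent vector of the graph of `u` at `(x, u x)` over the vector `v`. -/
def graphLift (u : EuclideanSpace ℝ (Fin n) → ℝ) (x v : EuclideanSpace ℝ (Fin n)) : Mink n :=
  (v, fderiv ℝ u x v)

/-- The future directed unit normal of the graph of `u`. -/
def graphNormal (u : EuclideanSpace ℝ (Fin n) → ℝ) (x : EuclideanSpace ℝ (Fin n)) : Mink n :=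
  (Real.sqrt (1 - ‖fderiv ℝ u x‖ ^ 2))⁻¹ •
    ((InnerProductSpace.toDual ℝ (EuclideanSpace ℝ (Fin n))).symm (fderiv ℝ u x), 1)

theorem lorentz_graphNormal (u : EuclideanSpace ℝ (Fin n) → ℝ) (x : EuclideanSpace ℝ (Fin n))
    (V : Mink n) : lorentz (graphNormal u x) V =
      (Real.sqrt (1 - ‖fderiv ℝ u x‖ ^ 2))⁻¹ * (fderiv ℝ u x V.1 - V.2) := by
  rw [graphNormal, lorentz_smul_left, lorentz, InnerProductSpace.toDual_symm_apply]
  simp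

theorem lorentz_graphNormal_graphLift (u : EuclideanSpace ℝ (Fin n) → ℝ)
    (x v : EuclideanSpace ℝ (Fin n)) : lorentz (graphNormal u x) (graphLift u x v) = 0 := by
  simp [lorentz_graphNormal, graphLift]

namespace IsEntireGraphIn

variable {u : EuclideanSpace ℝ (Fin n) → ℝ} {M : Set (Mink n)}

theorem differentiable (hu : IsEntireGraphIn u M) : Differentiable ℝ u :=
  hu.contDiff.differentiable (by norm_num)

theorem contDiff_fderiv (hu : IsEntireGraphIn u M) : ContDiff ℝ 1 (fderiv ℝ u) :=
  hu.contDiff.fderiv_right (by norm_num)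

theorem one_sub_sq_pos (hu : IsEntireGraphIn u M) (x : EuclideanSpace ℝ (Fin n)) :
    0 < 1 - ‖fderiv ℝ u x‖ ^ 2 := by
  nlinarith [hu.norm_fderiv_lt_one x, norm_nonneg (fderiv ℝ u x)]

theorem isTangent (hu : IsEntireGraphIn u M) (x v : EuclideanSpace ℝ (Fin n)) :
    IsTangent M (x, u x) (graphLift u x v) :=
  isTangent_graph (Eventually.of_forall hu.mem) (hu.differentiable x) v

/-- The graph is relatively open in `M`, so a curve in `M` through one of its points stays on it for
small times. -/
theorem eq_graphLift_of_isTangent (hu : IsEntireGraphIn u M) {x : EuclideanSpace ℝ (Fin n)}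
    {V : Mink n} (hV : IsTangent M (x, u x) V) : V = graphLift u x V.1 := by
  obtain ⟨γ, h0, hM, hγ⟩ := hV
  have ht : Tendsto γ (𝓝 0) (𝓝[M] (x, u x)) :=
    tendsto_nhdsWithin_iff.2 ⟨h0 ▸ hγ.continuousAt.tendsto, hM⟩
  have hγ1 : HasDerivAt (fun t => (γ t).1) V.1 0 := by
    simpa using hasDerivWithinAt_fst hγ.hasDerivWithinAt (s := univ)
  have hγ2 : HasDerivAt (fun t => (γ t).2) V.2 0 := by
    simpa using hasDerivWithinAt_snd hγ.hasDerivWithinAt (s := univ)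
  have h1 : HasDerivAt (fun t => u (γ t).1) (fderiv ℝ u x V.1) 0 :=
    HasFDerivAt.comp_hasDerivAt (0 : ℝ) (by simpa [h0] using (hu.differentiable x).hasFDerivAt)
      hγ1
  exact Prod.ext rfl (hγ2.unique (h1.congr_of_eventuallyEq
    (ht.eventually (hu.eventually_eq x))))

theorem lorentz_graphLift_self_pos (hu : IsEntireGraphIn u M) (x : EuclideanSpace ℝ (Fin n))
    {v : EuclideanSpace ℝ (Fin n)} (hv : v ≠ 0) :
    0 < lorentz (graphLift u x v) (graphLift u x v) := by
  have h1 := (fderiv ℝ u x).le_opNorm v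
  have h2 : ‖fderiv ℝ u x‖ * ‖v‖ < ‖v‖ :=
    mul_lt_of_lt_one_left (norm_pos_iff.2 hv) (hu.norm_fderiv_lt_one x)
  have h3 := sq_lt_sq' (by linarith [norm_nonneg (fderiv ℝ u x v), norm_nonneg v])
    (h1.trans_lt h2)
  rw [Real.norm_eq_abs, sq_abs] at h3
  simp only [lorentz, graphLift, real_inner_self_eq_norm_sq]
  linarith

theorem lorentz_graphLift_self_nonneg (hu : IsEntireGraphIn u M)
    (x v : EuclideanSpace ℝ (Fin n)) : 0 ≤ lorentz (graphLift u x v) (graphLift u x v) := by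
  by_cases hv : v = 0
  · simp [hv, graphLift, lorentz]
  · exact (hu.lorentz_graphLift_self_pos x hv).le

theorem lorentz_graphNormal_self (hu : IsEntireGraphIn u M) (x : EuclideanSpace ℝ (Fin n)) :
    lorentz (graphNormal u x) (graphNormal u x) = -1 := by
  have h1 := hu.one_sub_sq_pos x
  set w := (InnerProductSpace.toDual ℝ (EuclideanSpace ℝ (Fin n))).symm (fderiv ℝ u x) with hw
  have h2 : fderiv ℝ u x w = ‖fderiv ℝ u x‖ ^ 2 := by
    rw [← InnerProductSpace.toDual_symm_apply (y := fderiv ℝ u x) (x := w), ← hw,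
      real_inner_self_eq_norm_sq, hw, LinearIsometryEquiv.norm_map]
  rw [lorentz_graphNormal]
  simp only [graphNormal, ← hw, Prod.smul_fst, Prod.smul_snd, map_smul, h2, smul_eq_mul, mul_one]
  have h3 : (Real.sqrt (1 - ‖fderiv ℝ u x‖ ^ 2))⁻¹ ^ 2 * (1 - ‖fderiv ℝ u x‖ ^ 2) = 1 := by
    rw [inv_pow, Real.sq_sqrt h1.le, inv_mul_cancel₀ h1.ne']
  linear_combination -h3

theorem graphNormal_snd_pos (hu : IsEntireGraphIn u M) (x : EuclideanSpace ℝ (Fin n)) :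
    0 < (graphNormal u x).2 := by
  simpa [graphNormal] using hu.one_sub_sq_pos x

theorem isUnitNormal (hu : IsEntireGraphIn u M) (x : EuclideanSpace ℝ (Fin n)) :
    IsUnitNormal M (x, u x) (graphNormal u x) :=
  ⟨fun _ hV => by rw [hu.eq_graphLift_of_isTangent hV, lorentz_graphNormal_graphLift],
    hu.lorentz_graphNormal_self x, hu.graphNormal_snd_pos x⟩

/-- Makes tangency an algebraic condition, used for the derivative of the normal and for the
gradient. -/
theorem eq_graphLift_of_lorentz_graphNormal (hu : IsEntireGraphIn u M)
    {x : EuclideanSpace ℝ (Fin n)} {V : Mink n} (hV : lorentz (graphNormal u x) V = 0) :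
    V = graphLift u x V.1 := by
  rw [lorentz_graphNormal] at hV
  have h1 := (Real.sqrt_pos.2 (hu.one_sub_sq_pos x)).ne'
  rcases mul_eq_zero.1 hV with h | h
  · exact absurd (inv_eq_zero.1 h) h1
  · exact Prod.ext rfl (by simp only [graphLift]; linarith)

theorem differentiable_graphNormal (hu : IsEntireGraphIn u M) :
    Differentiable ℝ (graphNormal u) := by
  have h1 : Differentiable ℝ (fderiv ℝ u) := hu.contDiff_fderiv.differentiable (by norm_num)
  have h2 : Differentiable ℝ fun x => (InnerProductSpace.toDual ℝ
      (EuclideanSpace ℝ (Fin n))).symm (fderiv ℝ u x) := by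
    refine differentiable_euclidean.2 fun i => ?_
    have : ∀ L : EuclideanSpace ℝ (Fin n) →L[ℝ] ℝ, (InnerProductSpace.toDual ℝ
        (EuclideanSpace ℝ (Fin n))).symm L i = L (EuclideanSpace.single i 1) := fun L => by
      rw [← InnerProductSpace.toDual_symm_apply, EuclideanSpace.inner_single_right]
      simp
    simp only [this]
    exact h1.clm_apply (differentiable_const _)
  have h3 : Differentiable ℝ fun x => ‖fderiv ℝ u x‖ ^ 2 := by
    simpa using h2.norm_sq ℝ
  intro x
  have h4 := (((h3 x).const_sub 1).sqrt (hu.one_sub_sq_pos x).ne').inv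
    (Real.sqrt_pos.2 (hu.one_sub_sq_pos x)).ne'
  exact h4.smul ((h2 x).prodMk (differentiableAt_const _))

theorem hasDerivAt_graphNormal_line (hu : IsEntireGraphIn u M) (x v : EuclideanSpace ℝ (Fin n)) :
    HasDerivAt (fun t : ℝ => graphNormal u (x + t • v)) (fderiv ℝ (graphNormal u) x v) 0 := by
  have hline : HasDerivAt (fun t : ℝ => x + t • v) v 0 := by
    simpa using ((hasDerivAt_id (0 : ℝ)).smul_const v).const_add x
  exact HasFDerivAt.comp_hasDerivAt (0 : ℝ)
    (by simpa using (hu.differentiable_graphNormal x).hasFDerivAt) hline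

/-- Differentiating `⟨ν, ν⟩ = -1` shows that the derivative of `ν` is orthogonal to `ν`. -/
theorem fderiv_graphNormal_eq_graphLift (hu : IsEntireGraphIn u M)
    (x v : EuclideanSpace ℝ (Fin n)) :
    fderiv ℝ (graphNormal u) x v = graphLift u x (fderiv ℝ (graphNormal u) x v).1 := by
  have h := hu.hasDerivAt_graphNormal_line x v
  have h2 := hasDerivAt_lorentz h h
  simp only [hu.lorentz_graphNormal_self, zero_smul, add_zero] at h2
  have h3 := h2.unique (hasDerivAt_const _ _)
  rw [lorentz_comm] at h3
  exact hu.eq_graphLift_of_lorentz_graphNormal (by linarith)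

/-- The second fundamental form of the graph. -/
theorem lorentz_fderiv_graphNormal (hu : IsEntireGraphIn u M) (x v w : EuclideanSpace ℝ (Fin n)) :
    lorentz (fderiv ℝ (graphNormal u) x v) (graphLift u x w) =
      (graphNormal u x).2 * fderiv ℝ (fderiv ℝ u) x v w := by
  have h := hu.hasDerivAt_graphNormal_line x v
  have hline : HasDerivAt (fun t : ℝ => x + t • v) v 0 := by
    simpa using ((hasDerivAt_id (0 : ℝ)).smul_const v).const_add x
  have h1 : HasDerivAt (fun t : ℝ => fderiv ℝ u (x + t • v)) (fderiv ℝ (fderiv ℝ u) x v) 0 :=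
    HasFDerivAt.comp_hasDerivAt (0 : ℝ)
      (by simpa using (hu.contDiff_fderiv.differentiable (by norm_num) x).hasFDerivAt) hline
  have h2 : HasDerivAt (fun t : ℝ => graphLift u (x + t • v) w)
      (0, fderiv ℝ (fderiv ℝ u) x v w) 0 :=
    (hasDerivAt_const _ _).prodMk (by simpa using h1.clm_apply (hasDerivAt_const _ w))
  have h3 := hasDerivAt_lorentz h h2
  -- The pairing of `ν` with a lifted vector vanishes along the whole line, so its derivative is
  -- zero.
  simp only [lorentz_graphNormal_graphLift, zero_smul, add_zero] at h3
  have h4 := h3.unique (hasDerivAt_const _ _)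
  have h5 : lorentz (graphNormal u x) (0, fderiv ℝ (fderiv ℝ u) x v w) =
    -((graphNormal u x).2 * fderiv ℝ (fderiv ℝ u) x v w) := by simp [lorentz]
  linarith

/-- An eigenvector equation tested only against tangent vectors suffices: the defect is itself
tangent and the induced metric is positive definite. The normal is extended off the graph
independently of height. -/
theorem isPrincipalCurvature (hu : IsEntireGraphIn u M) {x v : EuclideanSpace ℝ (Fin n)} {κ : ℝ}
    (hv : v ≠ 0) (h : ∀ w, lorentz (fderiv ℝ (graphNormal u) x v) (graphLift u x w) =
      κ * lorentz (graphLift u x v) (graphLift u x w)) :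
    IsPrincipalCurvature M (x, u x) κ := by
  refine ⟨fun q => graphNormal u q.1, fderiv ℝ (graphNormal u) x ∘L .fst ℝ _ _, ?_, ?_,
    graphLift u x v, fun h0 => hv (congr_arg Prod.fst h0), hu.isTangent x v, ?_⟩
  · filter_upwards [hu.eventually_eq x] with q hq
    have : q = (q.1, u q.1) := Prod.ext rfl hq
    rw [this]
    exact hu.isUnitNormal q.1
  · exact (HasFDerivAt.comp (f := Prod.fst) (x, u x) (hu.differentiable_graphNormal x).hasFDerivAt
      hasFDerivAt_fst).hasFDerivWithinAt
  · set d := (fderiv ℝ (graphNormal u) x v).1 - κ • v with hd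
    have h1 : fderiv ℝ (graphNormal u) x v - κ • graphLift u x v = graphLift u x d := by
      rw [hu.fderiv_graphNormal_eq_graphLift x v]
      exact Prod.ext rfl (by simp [graphLift, hd])
    have h2 : lorentz (graphLift u x d) (graphLift u x d) = 0 := by
      nth_rewrite 1 [← h1]
      rw [lorentz_sub_left, lorentz_smul_left, h d, sub_self]
    have h3 : d = 0 := by
      by_contra hne
      exact (hu.lorentz_graphLift_self_pos x hne).ne' h2
    rw [h3] at h1
    have h4 : graphLift u x 0 = 0 := by simp [graphLift]
    exact sub_eq_zero.1 (h1.trans h4)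

/-- The second fundamental form is bounded by the bound of the principal curvatures. -/
theorem abs_lorentz_fderiv_graphNormal_le (hu : IsEntireGraphIn u M) {C₀ : ℝ}
    (hC : PrincipalCurvaturesBoundedBy M C₀) (x v : EuclideanSpace ℝ (Fin n)) :
    |lorentz (fderiv ℝ (graphNormal u) x v) (graphLift u x v)| ≤
      |C₀| * lorentz (graphLift u x v) (graphLift u x v) := by
  by_cases hv : v = 0
  · simp [hv, graphLift, lorentz]
  set g : EuclideanSpace ℝ (Fin n) →L[ℝ] EuclideanSpace ℝ (Fin n) →L[ℝ] ℝ :=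
    (isBoundedBilinearMap_inner (𝕜 := ℝ)).toContinuousLinearMap -
      (fderiv ℝ u x).smulRight (fderiv ℝ u x) with hg
  set h : EuclideanSpace ℝ (Fin n) →L[ℝ] EuclideanSpace ℝ (Fin n) →L[ℝ] ℝ :=
    (graphNormal u x).2 • fderiv ℝ (fderiv ℝ u) x with hh
  have hgl : ∀ v w, g v w = lorentz (graphLift u x v) (graphLift u x w) := fun v w => by
    simp [hg, lorentz, graphLift]
  have hhl : ∀ v w, h v w = lorentz (fderiv ℝ (graphNormal u) x v) (graphLift u x w) :=
    fun v w => by simp [hh, hu.lorentz_fderiv_graphNormal]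
  have hgs : ∀ v w, g v w = g w v := fun v w => by rw [hgl, hgl, lorentz_comm]
  have hgp : ∀ v, v ≠ 0 → 0 < g v v := fun v hv => by
    rw [hgl]
    exact hu.lorentz_graphLift_self_pos x hv
  have hsym : IsSymmSndFDerivAt ℝ u x :=
    hu.contDiff.contDiffAt.isSymmSndFDerivAt (by simp)
  have hhs : ∀ v w, h v w = h w v := fun v w => by
    simp only [hh, _root_.smul_apply, hsym.eq v w]
  rw [← hhl, ← hgl, abs_le]
  constructor
  -- The lower bound is the upper bound for `-h`, whose greatest eigenvalue is minus a principal
  -- curvature.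
  · obtain ⟨κ, v₀, hv₀, he, hle⟩ := exists_eigenvector_of_posDef g (-h) hgs hgp
      (fun v w => by simp [hhs v w]) hv
    have h1 : |(-κ)| ≤ C₀ := hC _ (hu.mem x) _ (hu.isPrincipalCurvature hv₀ fun w => by
      rw [← hhl, ← hgl]
      have := he w
      simp only [_root_.neg_apply] at this
      linarith)
    rw [abs_neg] at h1
    have h2 := mul_le_mul_of_nonneg_right ((le_abs_self κ).trans (h1.trans (le_abs_self C₀)))
      (hgp v hv).le
    simp only [_root_.neg_apply] at hle
    linarith
  · obtain ⟨κ, v₀, hv₀, he, hle⟩ := exists_eigenvector_of_posDef g h hgs hgp hhs hv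
    have h1 : |κ| ≤ C₀ := hC _ (hu.mem x) _ (hu.isPrincipalCurvature hv₀ fun w => by
      rw [← hhl, ← hgl, he w])
    exact hle.trans (mul_le_mul_of_nonneg_right ((le_abs_self κ).trans
      (h1.trans (le_abs_self C₀))) (hgp v hv).le)

end IsEntireGraphIn

/-! ### Maximum argument and gradient estimate -/

theorem eventually_lt_of_hasDerivAt_pos {f : ℝ → ℝ} {f' x : ℝ} (hf : HasDerivAt f f' x)
    (h : 0 < f') : ∀ᶠ t in 𝓝[<] x, f t < f x := by
  have h1 := (hasDerivAt_iff_tendsto_slope.1 hf).eventually (lt_mem_nhds h)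
  filter_upwards [nhdsWithin_mono x (fun t ht => ne_of_lt ht) h1, self_mem_nhdsWithin] with t ht htx
  rw [slope_def_field] at ht
  have htx' : t < x := htx
  rcases div_pos_iff.1 ht with h2 | h2 <;> linarith

/-- If `w` grows at most `C` times as fast as `z` in a direction of increase of `z`, then
`w - (C + 1) z` is maximal on the compact sublevel sets of `z` only at critical points of `z`. -/
theorem le_mul_of_isCompact_sublevel {F : Type*} [NormedAddCommGroup F] [NormedSpace ℝ F]
    {z w : F → ℝ} {C : ℝ} (hz : Continuous z) (hw : Continuous w)
    (hK : ∀ c, IsCompact {x | z x ≤ c})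
    (h : ∀ x, ∃ (g : F) (a b : ℝ), HasDerivAt (fun t : ℝ => z (x + t • g)) a 0 ∧
      HasDerivAt (fun t : ℝ => w (x + t • g)) b 0 ∧ b ≤ C * a ∧ 0 ≤ a ∧
      (a = 0 → w x ≤ (C + 1) * z x)) (x : F) : w x ≤ (C + 1) * z x := by
  obtain ⟨y, hy, hmax⟩ := (hK (z x)).exists_isMaxOn ⟨x, le_refl (z x)⟩
    (f := fun y => w y - (C + 1) * z y) (by fun_prop)
  have hxy : w x - (C + 1) * z x ≤ w y - (C + 1) * z y := 
    hmax (show x ∈ {y | z y ≤ z x} from le_refl (z x))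
  obtain ⟨g, a, b, ha, hb, hba, ha0, hcrit⟩ := h y
  rcases ha0.eq_or_lt with h0 | hpos
  · have := hcrit h0.symm
    linarith
  · exfalso
    have hφ : HasDerivAt (fun t : ℝ => (C + 1) * z (y + t • g) - w (y + t • g))
        ((C + 1) * a - b) 0 := (ha.const_mul _).sub hb
    -- For small `t < 0` both `z` and `(C + 1) z - w` decrease: the point stays in the sublevel set
    -- and beats the maximum.
    obtain ⟨t, ht1, ht2⟩ := ((eventually_lt_of_hasDerivAt_pos ha hpos).and
      (eventually_lt_of_hasDerivAt_pos hφ (by linarith))).exists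
    simp only [zero_smul, add_zero] at ht1 ht2
    have hy' : z y ≤ z x := hy
    have := hmax (show y + t • g ∈ {y | z y ≤ z x} from (ht1.le.trans hy'))
    simp only [mem_ofPred_eq] at this
    linarith

theorem fderiv_z (X v : Mink n) : fderiv ℝ z X v = lorentz X v := by
  have hd : DifferentiableAt ℝ (z : Mink n → ℝ) X := by
    have h1 : DifferentiableAt ℝ (fun X : Mink n => X.1) X := differentiableAt_fst
    have h2 : DifferentiableAt ℝ (fun X : Mink n => X.2) X := differentiableAt_snd
    have h3 : DifferentiableAt ℝ (fun X : Mink n => lorentz X X) X :=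
      (h1.inner ℝ h1).sub (h2.mul h2)
    have h4 : DifferentiableAt ℝ (fun X : Mink n => lorentz X X / 2) X := by
      simpa only [div_eq_mul_inv] using h3.mul_const (2 : ℝ)⁻¹
    exact h4
  have hline : HasDerivAt (fun t : ℝ => X + t • v) v 0 := by
    simpa using ((hasDerivAt_id (0 : ℝ)).smul_const v).const_add X
  have h1 : HasDerivAt (fun t : ℝ => z (X + t • v)) (fderiv ℝ z X v) 0 :=
    HasFDerivAt.comp_hasDerivAt (l := (z : Mink n → ℝ)) (0 : ℝ)
      (by simpa using hd.hasFDerivAt) hline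
  have h2 := (hasDerivAt_lorentz hline hline).div_const 2
  have h3 := h1.unique h2
  rw [h3, lorentz_comm v]
  simp

namespace IsEntireGraphIn

variable {u : EuclideanSpace ℝ (Fin n) → ℝ} {M : Set (Mink n)}

theorem abs_sub_le (hu : IsEntireGraphIn u M) (x y : EuclideanSpace ℝ (Fin n)) :
    |u x - u y| ≤ ‖x - y‖ :=
  abs_sub_le_norm_sub convex_univ isOpen_univ hu.differentiable.differentiableOn
    (fun x _ => hu.norm_fderiv_lt_one x) (mem_univ x) (mem_univ y)

/-- Strictness is what gives a positive gap `δ` on the unit sphere in `isCompact_sublevel`. -/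
theorem abs_sub_lt (hu : IsEntireGraphIn u M) {x y : EuclideanSpace ℝ (Fin n)} (hxy : x ≠ y) :
    |u x - u y| < ‖x - y‖ := by
  obtain ⟨c, -, hc⟩ := domain_mvt (f := u) (s := univ) (x := y) (y := x)
    (fun x _ => (hu.differentiable x).hasFDerivAt.hasFDerivWithinAt) convex_univ (mem_univ _)
    (mem_univ _)
  rw [hc, ← Real.norm_eq_abs]
  exact ((fderiv ℝ u c).le_opNorm _).trans_lt
    (mul_lt_of_lt_one_left (norm_pos_iff.2 (sub_ne_zero.2 hxy)) (hu.norm_fderiv_lt_one c))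

theorem two_mul_z_sub (u : EuclideanSpace ℝ (Fin n) → ℝ) (a : Mink n)
    (x : EuclideanSpace ℝ (Fin n)) :
    2 * z ((x, u x) - a) = ‖x - a.1‖ ^ 2 - |u x - a.2| ^ 2 := by
  simp only [z, lorentz, Prod.fst_sub, Prod.snd_sub, real_inner_self_eq_norm_sq, sq_abs]
  ring

theorem z_sub_nonneg (hu : IsEntireGraphIn u M) {a : Mink n} (ha : u a.1 = a.2)
    (x : EuclideanSpace ℝ (Fin n)) : 0 ≤ z ((x, u x) - a) := by
  have h1 := two_mul_z_sub u a x
  have h2 := hu.abs_sub_le x a.1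
  rw [ha] at h2
  nlinarith [pow_le_pow_left₀ (abs_nonneg _) h2 2]

theorem continuous_z_sub (hu : IsEntireGraphIn u M) (a : Mink n) :
    Continuous fun x => z ((x, u x) - a) := by
  have hc := hu.contDiff.continuous
  simp only [z, lorentz]
  fun_prop

/-- The sublevel sets of `z` on the graph are compact. -/
theorem isCompact_sublevel (hu : IsEntireGraphIn u M) {a : Mink n} (ha : u a.1 = a.2) (c : ℝ) :
    IsCompact {x | z ((x, u x) - a) ≤ c} := by
  have hc := hu.contDiff.continuous
  obtain ⟨δ, hδ, hδ1, hsph⟩ : ∃ δ : ℝ, 0 < δ ∧ δ ≤ 1 ∧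
      ∀ y ∈ Metric.sphere a.1 1, |u y - a.2| ≤ 1 - δ := by
    rcases (Metric.sphere a.1 1).eq_empty_or_nonempty with he | hne
    · exact ⟨1, one_pos, le_rfl, by simp [he]⟩
    · obtain ⟨y, hy, hmax⟩ := (isCompact_sphere a.1 1).exists_isMaxOn hne
        (f := fun y => |u y - a.2|) (by fun_prop)
      have hya : ‖y - a.1‖ = 1 := mem_sphere_iff_norm.1 hy
      have h1 := hu.abs_sub_lt (x := y) (y := a.1) (by
        intro h
        simp [h] at hya)
      rw [hya, ha] at h1
      exact ⟨1 - |u y - a.2|, by linarith, by linarith [abs_nonneg (u y - a.2)],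
        fun w hw => by simpa using hmax hw⟩
  refine Metric.isCompact_of_isClosed_isBounded
    (isClosed_le (hu.continuous_z_sub a) continuous_const)
    ((Metric.isBounded_closedBall (x := a.1) (r := max 1 (2 * c / δ))).subset fun x hx => ?_)
  rw [mem_closedBall_iff_norm]
  by_contra! hlt
  obtain ⟨hR1, hRc⟩ := max_lt_iff.1 hlt
  set R := ‖x - a.1‖ with hR
  have hR0 : 0 < R := one_pos.trans hR1
  set y := a.1 + R⁻¹ • (x - a.1) with hy
  have hys : y ∈ Metric.sphere a.1 1 := by
    simp [hy, norm_smul, ← hR, hR0.ne', abs_of_pos hR0]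
  have h1 : ‖x - y‖ = R - 1 := by
    have : x - y = (1 - R⁻¹) • (x - a.1) := by
      rw [hy, sub_smul, one_smul]
      abel
    rw [this, norm_smul, ← hR, Real.norm_eq_abs, abs_of_nonneg
      (sub_nonneg.2 (inv_le_one_of_one_le₀ hR1.le)), sub_mul, one_mul, inv_mul_cancel₀ hR0.ne']
  -- The gap `δ` gained at distance one persists along the ray, so `2z ≥ R² - (R - δ)² ≥ δ R`, which
  -- exceeds `2c`.
  have h2 : |u x - a.2| ≤ R - δ := by
    calc |u x - a.2| ≤ |u x - u y| + |u y - a.2| := _root_.abs_sub_le _ _ _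
      _ ≤ (R - 1) + (1 - δ) := add_le_add (h1 ▸ hu.abs_sub_le x y) (hsph y hys)
      _ = R - δ := by ring
  have h3 := two_mul_z_sub u a x
  have h4 : z ((x, u x) - a) ≤ c := hx
  have h5 := pow_le_pow_left₀ (abs_nonneg _) h2 2
  rw [div_lt_iff₀ hδ] at hRc
  nlinarith

end IsEntireGraphIn

/-- The gradient of `z (· - a)` restricted to the graph of `u`. -/
def graphGradient (u : EuclideanSpace ℝ (Fin n) → ℝ) (a : Mink n) (x : EuclideanSpace ℝ (Fin n)) :
    Mink n :=
  ((x, u x) - a) + lorentz ((x, u x) - a) (graphNormal u x) • graphNormal u x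

namespace IsEntireGraphIn

variable {u : EuclideanSpace ℝ (Fin n) → ℝ} {M : Set (Mink n)}

theorem lorentz_graphGradient_graphLift (u : EuclideanSpace ℝ (Fin n) → ℝ) (a : Mink n)
    (x v : EuclideanSpace ℝ (Fin n)) :
    lorentz (graphGradient u a x) (graphLift u x v) =
      lorentz ((x, u x) - a) (graphLift u x v) := by
  rw [graphGradient, lorentz_add_left, lorentz_smul_left, lorentz_graphNormal_graphLift]
  ring

/-- The normal part is removed by adding `⟨X - a, ν⟩ ν`, not subtracting it, because `⟨ν, ν⟩ = -1`.
-/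
theorem graphGradient_eq_graphLift (hu : IsEntireGraphIn u M) (a : Mink n)
    (x : EuclideanSpace ℝ (Fin n)) :
    graphGradient u a x = graphLift u x (graphGradient u a x).1 := by
  refine hu.eq_graphLift_of_lorentz_graphNormal ?_
  rw [lorentz_comm, graphGradient, lorentz_add_left, lorentz_smul_left,
    hu.lorentz_graphNormal_self]
  ring

/-- Reduces the gradient estimate to a bound on the support function. -/
theorem lorentz_graphGradient_self (hu : IsEntireGraphIn u M) (a : Mink n)
    (x : EuclideanSpace ℝ (Fin n)) :
    lorentz (graphGradient u a x) (graphGradient u a x) =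
      2 * z ((x, u x) - a) + lorentz ((x, u x) - a) (graphNormal u x) ^ 2 := by
  nth_rewrite 2 [hu.graphGradient_eq_graphLift]
  rw [lorentz_graphGradient_graphLift, ← hu.graphGradient_eq_graphLift, lorentz_comm,
    graphGradient, lorentz_add_left, lorentz_smul_left, lorentz_comm (graphNormal u x), z]
  ring

theorem hasDerivAt_graph_line (hu : IsEntireGraphIn u M) (a : Mink n)
    (x v : EuclideanSpace ℝ (Fin n)) :
    HasDerivAt (fun t : ℝ => ((x + t • v, u (x + t • v)) : Mink n) - a) (graphLift u x v) 0 := by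
  have hline : HasDerivAt (fun t : ℝ => x + t • v) v 0 := by
    simpa using ((hasDerivAt_id (0 : ℝ)).smul_const v).const_add x
  have h2 : HasDerivAt (fun t : ℝ => u (x + t • v)) (fderiv ℝ u x v) 0 :=
    HasFDerivAt.comp_hasDerivAt (0 : ℝ) (by simpa using (hu.differentiable x).hasFDerivAt) hline
  exact (hline.prodMk h2).sub_const a

/-- The support function `⟨X - a, ν⟩` is controlled by `z (X - a)`. -/
theorem abs_lorentz_graphNormal_le (hu : IsEntireGraphIn u M) {C₀ : ℝ}
    (hC : PrincipalCurvaturesBoundedBy M C₀) {a : Mink n} (ha : u a.1 = a.2)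
    (x : EuclideanSpace ℝ (Fin n)) :
    |lorentz ((x, u x) - a) (graphNormal u x)| ≤ (|C₀| + 1) * z ((x, u x) - a) := by
  have hw : Continuous fun x => lorentz ((x, u x) - a) (graphNormal u x) := by
    have h1 := hu.contDiff.continuous
    have h2 := hu.differentiable_graphNormal.continuous
    exact ((continuous_id.sub continuous_const).inner h2.fst).sub
      ((h1.sub continuous_const).mul h2.snd)
  have key : ∀ x, ∃ (g : EuclideanSpace ℝ (Fin n)) (α β : ℝ),
      HasDerivAt (fun t : ℝ => z ((x + t • g, u (x + t • g)) - a)) α 0 ∧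
      HasDerivAt (fun t : ℝ => lorentz ((x + t • g, u (x + t • g)) - a)
        (graphNormal u (x + t • g))) β 0 ∧ |β| ≤ |C₀| * α ∧ 0 ≤ α ∧
      (α = 0 → lorentz ((x, u x) - a) (graphNormal u x) = 0) := by
    intro x
    set g := (graphGradient u a x).1 with hg
    have hG : graphGradient u a x = graphLift u x g := hu.graphGradient_eq_graphLift a x
    have h1 := hu.hasDerivAt_graph_line a x g
    have hz := (hasDerivAt_lorentz h1 h1).div_const 2
    have hwd := hasDerivAt_lorentz h1 (hu.hasDerivAt_graphNormal_line x g)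
    simp only [zero_smul, add_zero] at hz hwd
    have hα : (lorentz (graphLift u x g) ((x, u x) - a) + lorentz ((x, u x) - a) (graphLift u x g))
        / 2 = lorentz (graphLift u x g) (graphLift u x g) := by
      rw [lorentz_comm (graphLift u x g) ((x, u x) - a), ← lorentz_graphGradient_graphLift, hG]
      ring
    -- The first term vanishes by orthogonality. In the second the derivative of `ν` is tangent, so
    -- `X - a` may be replaced by its tangential part `∇z`.
    have hβ : lorentz (graphLift u x g) (graphNormal u x) +
        lorentz ((x, u x) - a) (fderiv ℝ (graphNormal u) x g) =
        lorentz (fderiv ℝ (graphNormal u) x g) (graphLift u x g) := by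
      rw [lorentz_comm (graphLift u x g), lorentz_graphNormal_graphLift,
        hu.fderiv_graphNormal_eq_graphLift, ← lorentz_graphGradient_graphLift, hG, zero_add,
        lorentz_comm]
    refine ⟨g, _, _, hz, hwd, ?_, ?_, ?_⟩
    · rw [hα, hβ]
      exact hu.abs_lorentz_fderiv_graphNormal_le hC x g
    · rw [hα]
      exact hu.lorentz_graphLift_self_nonneg x g
    · rw [hα, ← hG, hu.lorentz_graphGradient_self]
      intro h0
      have h2 := hu.z_sub_nonneg ha x
      have : lorentz ((x, u x) - a) (graphNormal u x) ^ 2 = 0 := by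
        nlinarith [sq_nonneg (lorentz ((x, u x) - a) (graphNormal u x))]
      simpa using this
  have hnn : ∀ x, 0 ≤ (|C₀| + 1) * z ((x, u x) - a) := fun x =>
    mul_nonneg (by positivity) (hu.z_sub_nonneg ha x)
  rw [abs_le']
  constructor
  · refine le_mul_of_isCompact_sublevel (z := fun x => z ((x, u x) - a))
      (w := fun x => lorentz ((x, u x) - a) (graphNormal u x)) (hu.continuous_z_sub a) hw
      (hu.isCompact_sublevel ha) (fun x => ?_) x
    obtain ⟨g, α, β, h1, h2, h3, h4, h5⟩ := key x
    exact ⟨g, α, β, h1, h2, (le_abs_self β).trans h3, h4, fun h => (h5 h).trans_le (hnn x)⟩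
  · refine le_mul_of_isCompact_sublevel (z := fun x => z ((x, u x) - a))
      (w := fun x => -lorentz ((x, u x) - a) (graphNormal u x)) (hu.continuous_z_sub a) hw.neg
      (hu.isCompact_sublevel ha) (fun x => ?_) x
    obtain ⟨g, α, β, h1, h2, h3, h4, h5⟩ := key x
    exact ⟨g, α, -β, h1, h2.neg, (neg_le_abs β).trans h3, h4, fun h =>
      (by simp [h5 h] : -lorentz ((x, u x) - a) (graphNormal u x) = 0).trans_le (hnn x)⟩

/-- The gradient estimate for `z (· - a)`. -/
theorem lorentz_graphGradient_self_le (hu : IsEntireGraphIn u M) {C₀ : ℝ}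
    (hC : PrincipalCurvaturesBoundedBy M C₀) {a : Mink n} (ha : u a.1 = a.2)
    (x : EuclideanSpace ℝ (Fin n)) :
    lorentz (graphGradient u a x) (graphGradient u a x) ≤
      (1 + (|C₀| + 1) ^ 2) * (z ((x, u x) - a) + 1) ^ 2 := by
  rw [hu.lorentz_graphGradient_self, ← sq_abs (lorentz _ _)]
  have h1 := pow_le_pow_left₀ (abs_nonneg _) (hu.abs_lorentz_graphNormal_le hC ha x) 2
  have h2 := hu.z_sub_nonneg ha x
  have h3 : 0 ≤ (|C₀| + 1) ^ 2 := by positivity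
  -- Uses `2z ≤ (z + 1)²` and, as `z ≥ 0`, `z² ≤ (z + 1)²`.
  nlinarith [sq_nonneg (z ((x, u x) - a)), mul_nonneg h3 h2]

end IsEntireGraphIn

/-- On a closed connected spacelike hypersurface through the origin with bounded principal
curvatures, the gradient of `z` grows at most linearly in `z`. -/
theorem exists_isInducedGradient_le {M : Set (Mink n)} (hM : IsSpacelikeHypersurface M)
    (hMc : IsClosed M) (hconn : IsConnected M) (h0 : (0 : Mink n) ∈ M) {C₀ : ℝ}
    (hC : PrincipalCurvaturesBoundedBy M C₀) {X : Mink n} (hX : X ∈ M) :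
    ∃ G : Mink n, IsInducedGradient M z X G ∧
      lorentz G G ≤ (1 + (|C₀| + 1) ^ 2) * (z X + 1) ^ 2 := by
  obtain ⟨u, hu0, hu⟩ := hM.exists_isEntireGraphIn hMc h0
  have hXu : X = (X.1, u X.1) :=
    Prod.ext rfl (hu.eq_of_isPreconnected hconn.isPreconnected subset_rfl h0 hu0.symm hX)
  rw [hXu]
  refine ⟨graphGradient u 0 X.1, ⟨?_, fun v hv => ?_⟩, ?_⟩
  · rw [hu.graphGradient_eq_graphLift]
    exact hu.isTangent _ _
  · rw [hu.eq_graphLift_of_isTangent hv, IsEntireGraphIn.lorentz_graphGradient_graphLift, fderiv_z,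
      sub_zero]
  · simpa using hu.lorentz_graphGradient_self_le hC hu0 X.1

/-! ### Induced length and completeness -/

namespace IsEntireGraphIn

variable {u : EuclideanSpace ℝ (Fin n) → ℝ} {M : Set (Mink n)}

/-- Curves cannot change sheets, so the other components of `M` play no role in finite induced
distances. -/
theorem snd_eq_of_curve (hu : IsEntireGraphIn u M) {γ : ℝ → Mink n}
    (hγ : ContDiffOn ℝ 1 γ (Icc 0 1)) (hγM : ∀ t ∈ Icc (0 : ℝ) 1, γ t ∈ M)
    (h0 : (γ 0).2 = u (γ 0).1) {t : ℝ} (ht : t ∈ Icc (0 : ℝ) 1) : (γ t).2 = u (γ t).1 :=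
  hu.eq_of_isPreconnected (isPreconnected_Icc.image γ hγ.continuousOn)
    (image_subset_iff.2 hγM) (mem_image_of_mem γ (left_mem_Icc.2 zero_le_one)) h0
    (mem_image_of_mem γ ht)

theorem derivWithin_eq_graphLift (hu : IsEntireGraphIn u M) {γ : ℝ → Mink n}
    (hγ : ContDiffOn ℝ 1 γ (Icc 0 1)) (hγM : ∀ t ∈ Icc (0 : ℝ) 1, γ t ∈ M)
    (h0 : (γ 0).2 = u (γ 0).1) {t : ℝ} (ht : t ∈ Icc (0 : ℝ) 1) :
    derivWithin γ (Icc 0 1) t = graphLift u (γ t).1 (derivWithin γ (Icc 0 1) t).1 := by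
  have hd := (hγ.differentiableOn (by norm_num) t ht).hasDerivWithinAt
  have h1 := HasFDerivAt.comp_hasDerivWithinAt t (hu.differentiable (γ t).1).hasFDerivAt
    (hasDerivWithinAt_fst hd)
  have h2 := (hasDerivWithinAt_snd hd).congr (f₁ := u ∘ fun t => (γ t).1)
    (fun s hs => (hu.snd_eq_of_curve hγ hγM h0 hs).symm)
    (hu.snd_eq_of_curve hγ hγM h0 ht).symm
  exact Prod.ext rfl ((uniqueDiffOn_Icc zero_lt_one t ht).eq_deriv _ h2 h1)

/-- A function on the base whose differential is bounded with respect to the induced metric is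
Lipschitz along curves in the graph. -/
theorem norm_sub_le_of_inducedLength_le (hu : IsEntireGraphIn u M) {γ : ℝ → Mink n}
    (hγ : ContDiffOn ℝ 1 γ (Icc 0 1)) (hγM : ∀ t ∈ Icc (0 : ℝ) 1, γ t ∈ M)
    (h0 : (γ 0).2 = u (γ 0).1) {L B : ℝ} (hL : 0 ≤ L) (hB : 0 ≤ B)
    (hlen : inducedLength γ ≤ ENNReal.ofReal L)
    {G : Type*} [NormedAddCommGroup G] [NormedSpace ℝ G] [CompleteSpace G]
    {F : EuclideanSpace ℝ (Fin n) → G} (hF : ContDiff ℝ 1 F)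
    (hFB : ∀ t ∈ Icc (0 : ℝ) 1, ∀ v, ‖fderiv ℝ F (γ t).1 v‖ ≤
      B * Real.sqrt (lorentz (graphLift u (γ t).1 v) (graphLift u (γ t).1 v)))
    {t : ℝ} (ht : t ∈ Icc (0 : ℝ) 1) : ‖F (γ t).1 - F (γ 0).1‖ ≤ B * L := by
  set γ' := derivWithin γ (Icc 0 1) with hγ'
  set s : ℝ → ℝ := fun t => Real.sqrt (lorentz (γ' t) (γ' t)) with hs
  have hγ'c : ContinuousOn γ' (Icc 0 1) :=
    hγ.continuousOn_derivWithin (uniqueDiffOn_Icc zero_lt_one) le_rfl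
  have hsc : ContinuousOn s (Icc 0 1) := by
    have h1 : ContinuousOn (fun t => (γ' t).1) (Icc 0 1) := hγ'c.fst
    have h2 : ContinuousOn (fun t => (γ' t).2) (Icc 0 1) := hγ'c.snd
    exact ((h1.inner h1).sub (h2.mul h2)).sqrt
  have hs0 : ∀ t, 0 ≤ s t := fun t => Real.sqrt_nonneg _
  have hsint : IntervalIntegrable s volume 0 1 :=
    ContinuousOn.intervalIntegrable_of_Icc zero_le_one hsc
  have hs1 : ∫ t in (0 : ℝ)..1, s t ≤ L := by
    rw [intervalIntegral.integral_of_le zero_le_one, ← integral_Icc_eq_integral_Ioc]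
    rw [inducedLength, ← ofReal_integral_eq_lintegral_ofReal hsc.integrableOn_Icc
      (Eventually.of_forall hs0)] at hlen
    exact (ENNReal.ofReal_le_ofReal_iff hL).1 hlen
  have hsub : Icc (0 : ℝ) t ⊆ Icc 0 1 := Icc_subset_Icc_right ht.2
  have hd : ∀ r ∈ Icc (0 : ℝ) 1, HasDerivWithinAt (fun r => F (γ r).1)
      (fderiv ℝ F (γ r).1 (γ' r).1) (Icc 0 1) r := fun r hr =>
    HasFDerivAt.comp_hasDerivWithinAt r (hF.differentiable (by norm_num) (γ r).1).hasFDerivAt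
      (hasDerivWithinAt_fst (hγ.differentiableOn (by norm_num) r hr).hasDerivWithinAt)
  have hdc : ContinuousOn (fun r => fderiv ℝ F (γ r).1 (γ' r).1) (Icc 0 1) :=
    ((hF.continuous_fderiv (by norm_num)).comp_continuousOn hγ.continuousOn.fst).clm_apply hγ'c.fst
  have hFTC : ∫ r in (0 : ℝ)..t, fderiv ℝ F (γ r).1 (γ' r).1 = F (γ t).1 - F (γ 0).1 :=
    intervalIntegral.integral_eq_sub_of_hasDerivAt_of_le ht.1
      (fun r hr => (hd r (hsub hr)).continuousWithinAt.mono hsub)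
      (fun r hr => (hd r (hsub (Ioo_subset_Icc_self hr))).hasDerivAt
        (Icc_mem_nhds hr.1 (hr.2.trans_le ht.2)))
      (ContinuousOn.intervalIntegrable_of_Icc ht.1 (hdc.mono hsub))
  have hsint' : IntervalIntegrable s volume 0 t :=
    ContinuousOn.intervalIntegrable_of_Icc ht.1 (hsc.mono hsub)
  rw [← hFTC]
  calc ‖∫ r in (0 : ℝ)..t, fderiv ℝ F (γ r).1 (γ' r).1‖ ≤ ∫ r in (0 : ℝ)..t, B * s r := by
        refine intervalIntegral.norm_integral_le_of_norm_le ht.1 (ae_of_all _ fun r hr => ?_)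
          (hsint'.const_mul B)
        have hr' := hsub (Ioc_subset_Icc_self hr)
        have := hFB r hr' (γ' r).1
        rwa [← hu.derivWithin_eq_graphLift hγ hγM h0 hr'] at this
    _ = B * ∫ r in (0 : ℝ)..t, s r := intervalIntegral.integral_const_mul _ _
    _ ≤ B * ∫ r in (0 : ℝ)..1, s r := by
        refine mul_le_mul_of_nonneg_left ?_ hB
        exact intervalIntegral.integral_mono_interval le_rfl ht.1 ht.2
          (ae_of_all _ hs0) hsint
    _ ≤ B * L := mul_le_mul_of_nonneg_left hs1 hB

/-- Lifting a segment does not lengthen it, since the Lorentzian form subtracts the square of the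
vertical component. -/
theorem inducedEDist_le (hu : IsEntireGraphIn u M) (x y : EuclideanSpace ℝ (Fin n)) :
    inducedEDist M (x, u x) (y, u y) ≤ ENNReal.ofReal ‖y - x‖ := by
  have hlin : ContDiff ℝ 1 fun t : ℝ => x + t • (y - x) := by fun_prop
  have hu1 : ContDiff ℝ 1 u := hu.contDiff.of_le (by norm_num)
  refine (iInf₂_le (fun t : ℝ => (x + t • (y - x), u (x + t • (y - x))))
    ⟨(hlin.prodMk (hu1.comp hlin)).contDiffOn, fun t _ => hu.mem _, by simp, by simp⟩).trans ?_
  have hle : ∀ t ∈ Icc (0 : ℝ) 1, ENNReal.ofReal (Real.sqrt (lorentz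
      (derivWithin (fun t : ℝ => ((x + t • (y - x), u (x + t • (y - x))) : Mink n)) (Icc 0 1) t)
      (derivWithin (fun t : ℝ => ((x + t • (y - x), u (x + t • (y - x))) : Mink n)) (Icc 0 1) t)))
      ≤ ENNReal.ofReal ‖y - x‖ := by
    intro t ht
    have hline : HasDerivAt (fun t : ℝ => x + t • (y - x)) (y - x) t := by
      simpa using ((hasDerivAt_id t).smul_const (y - x)).const_add x
    have h2 : HasDerivAt (fun t : ℝ => u (x + t • (y - x)))
        (fderiv ℝ u (x + t • (y - x)) (y - x)) t :=
      HasFDerivAt.comp_hasDerivAt t (hu.differentiable _).hasFDerivAt hline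
    rw [(hline.prodMk h2).hasDerivWithinAt.derivWithin (uniqueDiffOn_Icc zero_lt_one t ht)]
    refine ENNReal.ofReal_le_ofReal (Real.sqrt_le_iff.2 ⟨norm_nonneg _, ?_⟩)
    simp only [lorentz, real_inner_self_eq_norm_sq]
    nlinarith [mul_self_nonneg (fderiv ℝ u (x + t • (y - x)) (y - x))]
  calc inducedLength _ ≤ ∫⁻ _ in Icc (0 : ℝ) 1, ENNReal.ofReal ‖y - x‖ :=
        setLIntegral_mono' measurableSet_Icc hle
    _ = ENNReal.ofReal ‖y - x‖ := by simp

/-- Cauchy–Schwarz for the induced metric, by the discriminant. -/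
theorem abs_lorentz_graphLift_le (hu : IsEntireGraphIn u M) (x v w : EuclideanSpace ℝ (Fin n)) :
    |lorentz (graphLift u x v) (graphLift u x w)| ≤
      Real.sqrt (lorentz (graphLift u x v) (graphLift u x v)) *
        Real.sqrt (lorentz (graphLift u x w) (graphLift u x w)) := by
  rw [← Real.sqrt_mul (hu.lorentz_graphLift_self_nonneg x v)]
  refine Real.abs_le_sqrt ?_
  have h : ∀ t : ℝ, 0 ≤ lorentz (graphLift u x w) (graphLift u x w) * (t * t) +
      2 * lorentz (graphLift u x v) (graphLift u x w) * t +
      lorentz (graphLift u x v) (graphLift u x v) := fun t => by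
    have h1 := hu.lorentz_graphLift_self_nonneg x (v + t • w)
    have h2 : graphLift u x (v + t • w) = graphLift u x v + t • graphLift u x w := by
      exact Prod.ext rfl (by simp [graphLift])
    rw [h2, lorentz_add_left, lorentz_comm (graphLift u x v), lorentz_add_left, lorentz_smul_left,
      lorentz_smul_left, lorentz_comm (graphLift u x w) (_ + _), lorentz_add_left,
      lorentz_smul_left, lorentz_comm (graphLift u x w) (graphLift u x v)] at h1
    linarith
  have := discrim_le_zero h
  rw [discrim] at this
  linarith

theorem contDiff_z_sub (hu : IsEntireGraphIn u M) (a : Mink n) :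
    ContDiff ℝ 1 fun x => z ((x, u x) - a) := by
  have h1 : ContDiff ℝ 1 u := hu.contDiff.of_le (by norm_num)
  have h2 : ContDiff ℝ 1 fun x => x - a.1 := contDiff_id.sub contDiff_const
  have h3 : ContDiff ℝ 1 fun x => u x - a.2 := h1.sub contDiff_const
  exact ((h2.inner ℝ h2).sub (h3.mul h3)).div_const 2

theorem contDiff_log_z (hu : IsEntireGraphIn u M) {a : Mink n} (ha : u a.1 = a.2) :
    ContDiff ℝ 1 fun x => Real.log (z ((x, u x) - a) + 1) :=
  ((hu.contDiff_z_sub a).add contDiff_const).log fun x => by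
    have := hu.z_sub_nonneg ha x
    positivity

/-- Linear growth of `|∇z|` in `z` is exactly what bounds the gradient of `log (z + 1)`, so `z`
cannot blow up within finite length. -/
theorem abs_fderiv_log_z_le (hu : IsEntireGraphIn u M) {C₀ : ℝ}
    (hC : PrincipalCurvaturesBoundedBy M C₀) {a : Mink n} (ha : u a.1 = a.2)
    (x v : EuclideanSpace ℝ (Fin n)) :
    |fderiv ℝ (fun x => Real.log (z ((x, u x) - a) + 1)) x v| ≤
      Real.sqrt (1 + (|C₀| + 1) ^ 2) *
        Real.sqrt (lorentz (graphLift u x v) (graphLift u x v)) := by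
  have hz := hu.z_sub_nonneg ha x
  have hz1 : 0 < z ((x, u x) - a) + 1 := by linarith
  have hline : HasDerivAt (fun t : ℝ => x + t • v) v 0 := by
    simpa using ((hasDerivAt_id (0 : ℝ)).smul_const v).const_add x
  have h1 : HasDerivAt (fun t : ℝ => Real.log (z ((x + t • v, u (x + t • v)) - a) + 1))
      (fderiv ℝ (fun x => Real.log (z ((x, u x) - a) + 1)) x v) 0 :=
    HasFDerivAt.comp_hasDerivAt (l := fun x => Real.log (z ((x, u x) - a) + 1)) (0 : ℝ)
      (by simpa using ((hu.contDiff_log_z ha).differentiable (by norm_num) x).hasFDerivAt) hline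
  have hl := hu.hasDerivAt_graph_line a x v
  have h2 := (((hasDerivAt_lorentz hl hl).div_const 2).add_const 1).log (by
    simpa [z] using hz1.ne')
  simp only [zero_smul, add_zero] at h2
  have h3 := h1.unique h2
  rw [h3, lorentz_comm (graphLift u x v), ← lorentz_graphGradient_graphLift]
  change |_ / (z ((x, u x) - a) + 1)| ≤ _
  rw [abs_div, abs_of_pos hz1, div_le_iff₀ hz1, add_self_div_two,
    hu.graphGradient_eq_graphLift a x]
  refine (hu.abs_lorentz_graphLift_le x _ v).trans ?_
  rw [← hu.graphGradient_eq_graphLift a x, mul_right_comm]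
  refine mul_le_mul_of_nonneg_right ?_ (Real.sqrt_nonneg _)
  refine (Real.sqrt_le_sqrt (hu.lorentz_graphGradient_self_le hC ha x)).trans ?_
  rw [Real.sqrt_mul (by positivity), Real.sqrt_sq hz1.le]

/-- On a compact set the Euclidean norm is bounded by the induced metric. -/
theorem exists_norm_le_mul_sqrt (hu : IsEntireGraphIn u M) {K : Set (EuclideanSpace ℝ (Fin n))}
    (hK : IsCompact K) : ∃ D : ℝ, 0 ≤ D ∧ ∀ x ∈ K, ∀ v,
      ‖v‖ ≤ D * Real.sqrt (lorentz (graphLift u x v) (graphLift u x v)) := by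
  rcases K.eq_empty_or_nonempty with rfl | hne
  · exact ⟨0, le_rfl, by simp⟩
  obtain ⟨y, -, hy⟩ := hK.exists_isMaxOn hne (f := fun x => ‖fderiv ℝ u x‖)
    hu.contDiff_fderiv.continuous.norm.continuousOn
  have hpos := hu.one_sub_sq_pos y
  refine ⟨(Real.sqrt (1 - ‖fderiv ℝ u y‖ ^ 2))⁻¹, by positivity, fun x hx v => ?_⟩
  have hxy : ‖fderiv ℝ u x‖ ≤ ‖fderiv ℝ u y‖ := hy hx
  have h1 : |fderiv ℝ u x v| ≤ ‖fderiv ℝ u y‖ * ‖v‖ :=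
    ((fderiv ℝ u x).le_opNorm v).trans (mul_le_mul_of_nonneg_right hxy (norm_nonneg _))
  have h2 := pow_le_pow_left₀ (abs_nonneg _) h1 2
  rw [inv_mul_eq_div, le_div_iff₀ (Real.sqrt_pos.2 hpos)]
  refine Real.le_sqrt_of_sq_le ?_
  rw [mul_pow, Real.sq_sqrt hpos.le]
  simp only [lorentz, graphLift, real_inner_self_eq_norm_sq]
  rw [sq_abs] at h2
  nlinarith

end IsEntireGraphIn

theorem exists_curve_of_inducedEDist_lt {M : Set (Mink n)} {p q : Mink n} {L : ℝ≥0∞}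
    (h : inducedEDist M p q < L) : ∃ γ : ℝ → Mink n, ContDiffOn ℝ 1 γ (Icc 0 1) ∧
      (∀ t ∈ Icc (0 : ℝ) 1, γ t ∈ M) ∧ γ 0 = p ∧ γ 1 = q ∧ inducedLength γ ≤ L := by
  rw [inducedEDist, iInf_lt_iff] at h
  obtain ⟨γ, h⟩ := h
  rw [iInf_lt_iff] at h
  obtain ⟨⟨h1, h2, h3, h4⟩, h⟩ := h
  exact ⟨γ, h1, h2, h3, h4, h.le⟩

/-- A closed spacelike hypersurface with bounded principal curvatures is complete. -/
theorem isInducedComplete_of_bounded {M : Set (Mink n)} (hM : IsSpacelikeHypersurface M)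
    (hMc : IsClosed M) {C₀ : ℝ} (hC : PrincipalCurvaturesBoundedBy M C₀) :
    IsInducedComplete M := by
  intro x hx hcau
  -- Centring `z` at a late term `x N` puts the whole tail within induced distance one of the base
  -- point, hence on one sheet.
  obtain ⟨N, hN⟩ := hcau 1 one_pos
  set a := x N with hadef
  obtain ⟨u, ha, hu⟩ := hM.exists_isEntireGraphIn (a := a) hMc (hx N)
  set B := Real.sqrt (1 + (|C₀| + 1) ^ 2) with hBdef
  have hB : 0 ≤ B := Real.sqrt_nonneg _
  set F : EuclideanSpace ℝ (Fin n) → ℝ := fun y => Real.log (z ((y, u y) - a) + 1) with hF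
  have hlog : ∀ {γ : ℝ → Mink n}, ContDiffOn ℝ 1 γ (Icc 0 1) →
      (∀ t ∈ Icc (0 : ℝ) 1, γ t ∈ M) → (γ 0).2 = u (γ 0).1 → inducedLength γ ≤ 1 →
      ∀ t ∈ Icc (0 : ℝ) 1, F (γ t).1 ≤ F (γ 0).1 + B := fun hγ hγM h0 hlen t ht => by
    have := hu.norm_sub_le_of_inducedLength_le hγ hγM h0 zero_le_one hB (by simpa using hlen)
      (hu.contDiff_log_z ha) (fun t _ v => hu.abs_fderiv_log_z_le hC ha _ v) ht
    have := (le_abs_self _).trans this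
    simp only [hF]
    linarith
  have hFa : F a.1 = 0 := by simp [hF, ha, z, lorentz]
  have htail : ∀ k ≥ N, (x k).2 = u (x k).1 ∧ F (x k).1 ≤ B := fun k hk => by
    obtain ⟨γ, h1, h2, h3, h4, h5⟩ := exists_curve_of_inducedEDist_lt (hN N le_rfl k hk)
    have h0 : (γ 0).2 = u (γ 0).1 := by rw [h3, ← hadef, ha]
    have hm : (1 : ℝ) ∈ Icc (0 : ℝ) 1 := right_mem_Icc.2 zero_le_one
    have h6 := hu.snd_eq_of_curve h1 h2 h0 hm
    have h7 := hlog h1 h2 h0 h5 1 hm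
    rw [h4] at h6 h7
    rw [h3, ← hadef, hFa, zero_add] at h7
    exact ⟨h6, h7⟩
  -- One `B` bounds `F` on the tail; the other is the most it can grow along a curve of length at
  -- most one issuing from the tail.
  obtain ⟨D, hD, hDK⟩ := hu.exists_norm_le_mul_sqrt
    (hu.isCompact_sublevel ha (Real.exp (B + B)))
  have hdist : ∀ k ≥ N, ∀ l, ∀ L : ℝ, 0 ≤ L → L ≤ 1 →
      inducedEDist M (x k) (x l) < ENNReal.ofReal L → ‖(x l).1 - (x k).1‖ ≤ D * L := by
    intro k hk l L hL hL1 hlt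
    obtain ⟨γ, h1, h2, h3, h4, h5⟩ := exists_curve_of_inducedEDist_lt hlt
    have h0 : (γ 0).2 = u (γ 0).1 := by rw [h3, (htail k hk).1]
    have hlen1 : inducedLength γ ≤ 1 := h5.trans (by simpa using hL1)
    have := hu.norm_sub_le_of_inducedLength_le h1 h2 h0 hL hD h5 contDiff_id (fun t ht v => ?_)
      (right_mem_Icc.2 zero_le_one)
    · simpa [h3, h4] using this
    · have h6 := hlog h1 h2 h0 hlen1 t ht
      rw [h3] at h6
      have h7 : F (γ t).1 ≤ B + B := h6.trans (by linarith [(htail k hk).2])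
      have h8 := hu.z_sub_nonneg ha (γ t).1
      rw [hF, Real.log_le_iff_le_exp (by linarith)] at h7
      have h9 : (γ t).1 ∈ {y | z ((y, u y) - a) ≤ Real.exp (B + B)} := by
        simp only [mem_ofPred_eq]
        linarith
      simpa using hDK _ h9 v
  have hcs : CauchySeq fun k => (x k).1 := by
    rw [Metric.cauchySeq_iff]
    intro ε hε
    -- The cap `1` keeps curves in the compact set; `D + 1` allows `D = 0` and makes the final
    -- inequality strict.
    set L := min 1 (ε / (D + 1)) with hLdef
    have hLpos : 0 < L := lt_min one_pos (by positivity)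
    obtain ⟨N', hN'⟩ := hcau (ENNReal.ofReal L) (by simpa using hLpos)
    refine ⟨max N N', fun k hk l hl => ?_⟩
    have h1 := hdist l ((le_max_left _ _).trans hl) k L hLpos.le (min_le_left _ _)
      (hN' l ((le_max_right _ _).trans hl) k ((le_max_right _ _).trans hk))
    rw [dist_eq_norm]
    refine h1.trans_lt ?_
    have h2 : L * (D + 1) ≤ ε := (le_div_iff₀ (by linarith)).1 (min_le_right _ _)
    linarith
  obtain ⟨y, hy⟩ := cauchySeq_tendsto_of_complete hcs
  refine ⟨(y, u y), hu.mem y, ?_⟩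
  have hlim : Tendsto (fun k => ENNReal.ofReal ‖y - (x k).1‖) atTop (𝓝 0) := by
    have : Tendsto (fun k => ‖y - (x k).1‖) atTop (𝓝 0) := by
      simpa using (tendsto_const_nhds (x := y).sub hy).norm
    simpa using ENNReal.tendsto_ofReal this
  refine tendsto_of_tendsto_of_tendsto_of_le_of_le' tendsto_const_nhds hlim
    (Eventually.of_forall fun k => bot_le) ?_
  filter_upwards [eventually_ge_atTop N] with k hk
  have : x k = ((x k).1, u (x k).1) := Prod.ext rfl (htail k hk).1
  rw [this]
  exact hu.inducedEDist_le _ _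

end Mink

end

theorem proposition6p1 :
    (∀ C₀ : ℝ, ∃ C : ℝ, ∀ (n : ℕ) (M : Set (Mink n)), 1 ≤ n →
      Mink.IsSpacelikeHypersurface M → IsClosed M → IsConnected M → (0 : Mink n) ∈ M →
      Mink.PrincipalCurvaturesBoundedBy M C₀ →
      ∀ X ∈ M, ∃ G : Mink n, Mink.IsInducedGradient M Mink.z X G ∧
        Mink.lorentz G G ≤ C * (Mink.z X + 1) ^ 2) ∧
    (∀ (n : ℕ) (M : Set (Mink n)), 1 ≤ n →
      Mink.IsSpacelikeHypersurface M → IsClosed M →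
      (∃ C₀ : ℝ, Mink.PrincipalCurvaturesBoundedBy M C₀) →
      Mink.IsInducedComplete M) := by
  refine ⟨fun C₀ => ⟨1 + (|C₀| + 1) ^ 2, fun n M _ hM hMc hconn h0 hC X hX => ?_⟩, ?_⟩
  · exact Mink.exists_isInducedGradient_le hM hMc hconn h0 hC hX
  · rintro n M - hM hMc ⟨C₀, hC⟩
    exact Mink.isInducedComplete_of_bounded hM hMc hC
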